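/- Let $M\subset\mathbb R^d$ be a compact embedded $d'$-dimensional $\mathcal C^2$ submanifold, possibly with boundary $\partial M$ and possibly disconnected, with the Riemannian metric inherited from $\mathbb R^d$. Let $\rho$ be its geodesic distance (the infimum of the lengths of $\mathcal C^1$ paths in $M$, equal to $\infty$ if there are none), and let $\rho(x,\partial M)=\inf_{y\in\partial M}\rho(x,y)$, equal to $\infty$ if $\partial M=\emptyset$. Let $X_1,X_2,\dots$ be i.i.d. random vectors in $\mathbb R^d$ whose common law is concentrated on $M$ and has a $\mathcal C^2$ density $f:M\to[0,\infty)$ with respect to the Riemannian volume measure of $M$ (the $d'$-dimensional Hausdorff measure on $M$, normalised to be Lebesgue measure on $\mathbb R^{d'}$). Let $h=h_n>0$ and $\beta_n$ be deterministic sequences of real numbers such that, as $n\to\infty$, $$h\to0,\qquad \beta_n\to\infty,\qquad \beta_nh^2\to0,\qquad \frac{nh^{d'}}{\beta_n^2\log n}\to\infty,$$ and let $$\hat f_{h,n}(x)=\frac1{nh^{d'}}\sum_{i=1}^n K\Big(\frac{\|x-X_i\|}{h}\Big),\qquad K(t)=\pi^{-d'/2}e^{-t^2}.$$ Then, for every closed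 subset $M_0\subset M$ with $\inf_{x\in M_0}\rho(x,\partial M)>0$, $$\beta_n\sup_{x\in M_0}\big|\hat f_{h,n}(x)-f(x)\big|\to0\quad\text{almost surely.}$$ -/

import Mathlib

open MeasureTheory ProbabilityTheory Filter Topology Set

open scoped ENNReal

noncomputable section

namespace ManifoldKDE

/-- The Euclidean space `ℝ^d`. -/
abbrev E (d : ℕ) : Type := EuclideanSpace ℝ (Fin d)

/-- The coordinate `k`-plane `ℝ^k × {0}` in `ℝ^d`. -/
def slice (d k : ℕ) : Set (E d) :=
  {y | ∀ i : Fin d, k ≤ i.val → y i = 0}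

/-- `Φ` is a `C²` diffeomorphism between two open subsets of `ℝ^d`. -/
def IsC2Diffeo {d : ℕ} (Φ : OpenPartialHomeomorph (E d) (E d)) : Prop :=
  ContDiffOn ℝ 2 Φ Φ.source ∧ ContDiffOn ℝ 2 Φ.symm Φ.target

/-- `p` is an interior point of the `k`-dimensional `C²` submanifold `M`: around `p`, a `C²` change
of coordinates of the ambient space straightens `M` to `ℝ^k × {0}`. -/
def IsInteriorPt {d : ℕ} (k : ℕ) (M : Set (E d)) (p : E d) : Prop :=
  ∃ Φ : OpenPartialHomeomorph (E d) (E d), IsC2Diffeo Φ ∧ p ∈ Φ.source ∧ p ∈ M ∧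
    ∀ x ∈ Φ.source, (x ∈ M ↔ Φ x ∈ slice d k)

/-- `p` is a boundary point of the `k`-dimensional `C²` submanifold `M`: around `p`, a `C²` change
of coordinates of the ambient space straightens `M` to the half-space `{y_k ≥ 0}` of
`ℝ^k × {0}` (the `k`-th coordinate has index `k - 1`, so there are none for `k = 0`), and sends `p`
to a point of the hyperplane `{y_k = 0}`. -/
def IsBoundaryPt {d : ℕ} (k : ℕ) (M : Set (E d)) (p : E d) : Prop :=
  ∃ j : Fin d, j.val + 1 = k ∧
    ∃ Φ : OpenPartialHomeomorph (E d) (E d), IsC2Diffeo Φ ∧ p ∈ Φ.source ∧ p ∈ M ∧ Φ p j = 0 ∧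
      ∀ x ∈ Φ.source, (x ∈ M ↔ Φ x ∈ slice d k ∧ 0 ≤ Φ x j)

/-- `M` is an (embedded) `k`-dimensional `C²` submanifold of `ℝ^d`, possibly with boundary. It need
not be connected. -/
def IsC2Submanifold {d : ℕ} (k : ℕ) (M : Set (E d)) : Prop :=
  k ≤ d ∧ ∀ p ∈ M, IsInteriorPt k M p ∨ IsBoundaryPt k M p

/-- The manifold boundary `∂M`. -/
def bdry {d : ℕ} (k : ℕ) (M : Set (E d)) : Set (E d) :=
  {p | IsBoundaryPt k M p}

/-- The geodesic distance `ρ(x, y)` in `M`: the infimum of the lengths of the `C¹` paths in `M`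
from `x` to `y` (it is `∞` if there are none). -/
def geodesicDist {d : ℕ} (M : Set (E d)) (x y : E d) : ℝ≥0∞ :=
  ⨅ (γ : ℝ → E d) (_ : ContDiffOn ℝ 1 γ (Icc 0 1)) (_ : MapsTo γ (Icc 0 1) M)
    (_ : γ 0 = x) (_ : γ 1 = y), ∫⁻ t in Icc (0 : ℝ) 1, ‖derivWithin γ (Icc 0 1) t‖ₑ

/-- The geodesic distance `ρ(x, A) = inf_{y ∈ A} ρ(x, y)`; it is `∞` for `A = ∅`. -/
def geodesicDistSet {d : ℕ} (M : Set (E d)) (x : E d) (A : Set (E d)) : ℝ≥0∞ :=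
  ⨅ y ∈ A, geodesicDist M x y

/-- The Riemannian volume measure of a `k`-dimensional submanifold `M` of `ℝ^d`, as a measure on
`ℝ^d`: the `k`-dimensional Hausdorff measure on `M`, normalised so that it is Lebesgue measure on
`ℝ^k`. -/
def volumeMeasure {d : ℕ} (k : ℕ) (M : Set (E d)) : Measure (E d) :=
  (Measure.euclideanHausdorffMeasure k).restrict M

/-- The restriction of `f` to `M` is a `C²` function: near each point of `M` it is the restriction
of a `C²` function on an open subset of `ℝ^d`. The values of `f` outside `M` play no role. -/
def IsC2FunctionOn {d : ℕ} (f : E d → ℝ) (M : Set (E d)) : Prop :=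
  ∀ p ∈ M, ∃ U : Set (E d), IsOpen U ∧ p ∈ U ∧
    ∃ F : E d → ℝ, ContDiffOn ℝ 2 F U ∧ EqOn f F (M ∩ U)

/-- The Gaussian kernel `K(t) = π^(-k/2) exp(-t²)` of dimension `k`. -/
def gaussKernel (k : ℕ) (t : ℝ) : ℝ :=
  Real.pi ^ (-(k : ℝ) / 2) * Real.exp (-t ^ 2)

/-- The kernel density estimator
`(1 / (n h^k)) ∑ K(‖x - X_i‖ / h)` at `x`, where the sum runs over the `n` points
`X_0, …, X_(n-1)`. -/
def kernelEstimator {d : ℕ} (k : ℕ) (h : ℝ) (n : ℕ) (X : ℕ → E d) (x : E d) : ℝ :=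
  1 / (n * h ^ k) * ∑ i ∈ Finset.range n, gaussKernel k (‖x - X i‖ / h)

end ManifoldKDE

end

/-!
The error splits into the bias of the estimator, which is `O(h²)` uniformly on `M₀`, and its
fluctuation, which is almost surely `o(1 / β)` uniformly on `M₀`.

*Bias.* The set `M₀` is compact and consists of interior points, so it suffices to bound the bias
uniformly near one interior point. At each nearby point `x` of `M`, the manifold is a graph over its
tangent plane, with constants independent of `x` (`IsInteriorPt.exists_isGraphOver`). In the
coordinates `u` of the orthogonal projection to the tangent plane, every quantity agrees with its
flat counterpart up to second order: `‖y - x‖² = ‖u‖² + O(‖u‖⁴)`, the density is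
`f x + (linear in u) + O(‖u‖²)`, and the volume is `(1 + O(‖u‖²)) du`. In a general `C²` chart,
`‖y - x‖²` would have a cubic term, with a remainder that is too large after division by `h²`.
The statement on the volume (`IsGraphOver.exists_map_eq_add`) needs no area formula: the projection
is `1`-Lipschitz and its inverse is Lipschitz with constant `1 + O(ρ²)` on the ball of radius `ρ`,
which compares Hausdorff measures on dyadic shells. Integrating against the Gaussian, the linear
term cancels by symmetry and the remaining errors are at most a constant times
`h² exp (-‖u‖² / (2h²))`, of integral `O(h^(k + 2))` (`IsGraphOver.abs_integral_sub_le`).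

*Fluctuation.* The summands `exp (-‖x - X i‖² / h²)` lie in `[0, 1]` and have mean, hence variance,
`O(h^k)`. A Bernstein inequality (`measureReal_abs_sum_sub_ge_le`) bounds the probability that the
fluctuation at a given point exceeds `ε / β` by `2 exp (-c n h^k / β²)`, which by the rate
assumption decays faster than any power of `n`. The union bound over nets of polynomial size
(`exists_nets`), the Lipschitz continuity of the kernel and the Borel-Cantelli lemma give the
uniform statement (`ae_eventually_abs_sum_sub_le`).
-/

open MeasureTheory ProbabilityTheory Filter Topology Set

open scoped ENNReal

namespace ManifoldKDE

/-! ### Parametrizations and orthogonal projections -/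

/-- A `C²` function is, uniformly near a point, approximated by its derivative at `a` with relative
error `O(σ)` on the ball of radius `σ` around `a`: this is the mean value inequality, as the
derivative is Lipschitz. -/
theorem exists_fderiv_expansion {V W : Type*} [NormedAddCommGroup V] [NormedSpace ℝ V]
    [NormedAddCommGroup W] [NormedSpace ℝ W] {g : V → W} {a₀ : V} (hg : ContDiffAt ℝ 2 g a₀) :
    ∃ K t : ℝ, 0 < K ∧ 0 < t ∧
      (∀ a ∈ Metric.ball a₀ t, ‖fderiv ℝ g a‖ ≤ K) ∧
      (∀ a ∈ Metric.ball a₀ t, DifferentiableAt ℝ g a) ∧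
      ∀ a ∈ Metric.ball a₀ t, ∀ b ∈ Metric.ball a₀ t, ∀ c ∈ Metric.ball a₀ t, ∀ σ : ℝ,
        ‖b - a‖ ≤ σ → ‖c - a‖ ≤ σ → ‖g b - g c - fderiv ℝ g a (b - c)‖ ≤ K * σ * ‖b - c‖ := by
  obtain ⟨K, s, hs, hK⟩ := (hg.fderiv_right (m := 1) (by norm_num)).exists_lipschitzOnWith
  have hd : ∀ᶠ a in 𝓝 a₀, DifferentiableAt ℝ g a :=
    (hg.eventually (by simp)).mono fun a ha => ha.differentiableAt (by simp)
  have hbd : ∀ᶠ a in 𝓝 a₀, ‖fderiv ℝ g a‖ < ‖fderiv ℝ g a₀‖ + 1 :=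
    ((hg.fderiv_right (m := 1) (by norm_num)).continuousAt.norm).eventually_lt_const (by simp)
  obtain ⟨t, ht, hts⟩ := Metric.mem_nhds_iff.1 (inter_mem hs (hd.and hbd))
  have hpos := norm_nonneg (fderiv ℝ g a₀)
  have hK0 : (0 : ℝ) ≤ K := K.2
  refine ⟨K + (‖fderiv ℝ g a₀‖ + 1), t, by linarith, ht,
    fun a ha => by linarith [(hts ha).2.2.le],
    fun a ha => (hts ha).2.1, ?_⟩
  intro a ha b hb c hc σ hbσ hcσ
  have hσ : 0 ≤ σ := (norm_nonneg _).trans hbσ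
  have hconv := (convex_ball a₀ t).inter (convex_closedBall a σ)
  have key := hconv.norm_image_sub_le_of_norm_fderiv_le' (f := g) (φ := fderiv ℝ g a)
    (C := K * σ) (x := c) (y := b)
    (fun z hz => (hts hz.1).2.1) (fun z hz => ?_) ⟨hc, by simpa [dist_eq_norm] using hcσ⟩
    ⟨hb, by simpa [dist_eq_norm] using hbσ⟩
  · refine key.trans ?_
    gcongr
    linarith
  · have := hK.dist_le_mul z (hts hz.1).1 a (hts ha).1
    rw [dist_eq_norm] at this
    exact this.trans (by have := hz.2; rw [Metric.mem_closedBall] at this; gcongr)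

/-- Extension of a vector of `ℝ^k` by zeros to a vector of `ℝ^d`. -/
noncomputable def zeroPad (k d : ℕ) : E k →L[ℝ] E d :=
  LinearMap.toContinuousLinearMap
    { toFun := fun v => WithLp.toLp 2 fun i : Fin d => if h : i.val < k then v ⟨i.val, h⟩ else 0
      map_add' := fun v w => by ext i; by_cases h : i.val < k <;> simp [h]
      map_smul' := fun c v => by ext i; by_cases h : i.val < k <;> simp [h] }

theorem zeroPad_apply (k d : ℕ) (v : E k) (i : Fin d) :
    zeroPad k d v i = if h : i.val < k then v ⟨i.val, h⟩ else 0 := rfl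

theorem zeroPad_zeroPad {k d : ℕ} (hkd : k ≤ d) (v : E k) : zeroPad d k (zeroPad k d v) = v := by
  ext i
  have : i.val < d := i.2.trans_le hkd
  simp [zeroPad_apply, this]

theorem zeroPad_mem_slice (k d : ℕ) (v : E k) : zeroPad k d v ∈ slice d k := fun i hi => by
  simp [zeroPad_apply, hi]

theorem zeroPad_zeroPad_of_mem_slice {k d : ℕ} {y : E d} (hy : y ∈ slice d k) :
    zeroPad k d (zeroPad d k y) = y := by
  ext i
  by_cases h : i.val < k
  · simp [zeroPad_apply, h]
  · simp [zeroPad_apply, h, hy i (not_lt.1 h)]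

/-- A `C²` parametrization `ψ` of `M` near an interior point, together with an ambient `C²` function
`τ` that inverts it. -/
theorem IsInteriorPt.exists_parametrization {d k : ℕ} (hkd : k ≤ d) {M : Set (E d)} {p : E d}
    (hp : IsInteriorPt k M p) :
    ∃ (ψ : E k → E d) (τ : E d → E k), ContDiffAt ℝ 2 ψ (τ p) ∧ ContDiffAt ℝ 2 τ p ∧ ψ (τ p) = p ∧
      (∀ᶠ y in 𝓝 p, y ∈ M → ψ (τ y) = y) ∧ ∀ᶠ a in 𝓝 (τ p), ψ a ∈ M ∧ τ (ψ a) = a := by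
  obtain ⟨Φ, ⟨h1, h2⟩, hps, hpM, hM⟩ := hp
  have hpz : zeroPad k d (zeroPad d k (Φ p)) = Φ p :=
    zeroPad_zeroPad_of_mem_slice ((hM p hps).1 hpM)
  have hev : ∀ᶠ a in 𝓝 (zeroPad d k (Φ p)), zeroPad k d a ∈ Φ.target :=
    (zeroPad k d).continuous.continuousAt.eventually_mem
      (Φ.open_target.mem_nhds (by rw [hpz]; exact Φ.map_source hps))
  refine ⟨fun a => Φ.symm (zeroPad k d a), fun y => zeroPad d k (Φ y), ?_, ?_, ?_, ?_, ?_⟩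
  · refine ContDiffAt.comp (g := Φ.symm) (zeroPad d k (Φ p)) ?_ (zeroPad k d).contDiff.contDiffAt
    rw [hpz]
    exact h2.contDiffAt (Φ.open_target.mem_nhds (Φ.map_source hps))
  · exact (zeroPad d k).contDiff.contDiffAt.comp p (h1.contDiffAt (Φ.open_source.mem_nhds hps))
  · simp only [hpz, Φ.left_inv hps]
  · filter_upwards [Φ.open_source.mem_nhds hps] with y hy hyM
    simp only [zeroPad_zeroPad_of_mem_slice ((hM y hy).1 hyM), Φ.left_inv hy]
  · filter_upwards [hev] with a ha
    refine ⟨(hM _ (Φ.map_target ha)).2 ?_, ?_⟩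
    · rw [Φ.right_inv ha]; exact zeroPad_mem_slice k d a
    · simp only [Φ.right_inv ha, zeroPad_zeroPad hkd]

section Proj
variable {d k : ℕ}

/-- For an isometric embedding `L : ℝ^k → ℝ^d`, the coordinates in `ℝ^k` of the orthogonal
projection onto the range of `L`, that is, the adjoint of `L`. -/
noncomputable def proj (L : E k →ₗᵢ[ℝ] E d) : E d →L[ℝ] E k :=
  L.toContinuousLinearMap.adjoint

theorem proj_apply_self (L : E k →ₗᵢ[ℝ] E d) (u : E k) : proj L (L u) = u := by
  refine ext_inner_right ℝ fun w => ?_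
  rw [proj, ContinuousLinearMap.adjoint_inner_left]
  exact L.inner_map_map u w

/-- Pythagoras for the tangential part `L (proj L v)` and the normal part of `v`. -/
theorem norm_sq_eq_proj (L : E k →ₗᵢ[ℝ] E d) (v : E d) :
    ‖v‖ ^ 2 = ‖proj L v‖ ^ 2 + ‖v - L (proj L v)‖ ^ 2 := by
  have h : inner ℝ (L (proj L v)) (v - L (proj L v)) = 0 := by
    have := ContinuousLinearMap.adjoint_inner_right L.toContinuousLinearMap (proj L v)
      (v - L (proj L v))
    change inner ℝ _ (proj L _) = inner ℝ (L (proj L v)) _ at this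
    rw [← this, map_sub, proj_apply_self, sub_self, inner_zero_right]
  have := norm_add_sq_eq_norm_sq_add_norm_sq_of_inner_eq_zero _ _ h
  rw [add_sub_cancel, L.norm_map] at this
  nlinarith

theorem norm_proj_le (L : E k →ₗᵢ[ℝ] E d) (v : E d) : ‖proj L v‖ ≤ ‖v‖ := by
  have := norm_sq_eq_proj L v
  exact le_of_sq_le_sq (by nlinarith [sq_nonneg ‖v - L (proj L v)‖]) (norm_nonneg _)

/-- The orthogonal projection is the best approximation from the range of `L`. -/
theorem norm_sub_proj_le (L : E k →ₗᵢ[ℝ] E d) (v : E d) (u : E k) :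
    ‖v - L (proj L v)‖ ≤ ‖v - L u‖ := by
  have := norm_sq_eq_proj L (v - L u)
  rw [map_sub, proj_apply_self, map_sub, sub_sub_sub_cancel_right] at this
  exact le_of_sq_le_sq (by nlinarith [sq_nonneg ‖proj L v - u‖]) (norm_nonneg _)

end Proj

/-- An isometric embedding onto the range of an injective linear map. -/
theorem exists_linearIsometry_range {d k : ℕ} (A : E k →L[ℝ] E d) (hA : Function.Injective A) :
    ∃ L : E k →ₗᵢ[ℝ] E d, ∀ v, ∃ u, A v = L u := by
  have hfr : Module.finrank ℝ (LinearMap.range A.toLinearMap) = k := by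
    rw [LinearMap.finrank_range_of_inj hA]; simp
  let e := (stdOrthonormalBasis ℝ (LinearMap.range A.toLinearMap)).reindex (finCongr hfr)
  refine ⟨(LinearMap.range A.toLinearMap).subtypeₗᵢ.comp e.repr.symm.toLinearIsometry,
    fun v => ⟨e.repr ⟨A v, v, rfl⟩, ?_⟩⟩
  simp

/-! ### The submanifold as a graph over its tangent planes -/

/-- Near its point `x`, the set `M` is the graph of a function on the `k`-plane `x + L(ℝ^k)`, to
which it is tangent at `x` up to second order: the slope between two points of `M` at distance at
most `ρ ≤ s` of `x` is at most `C * ρ`, and the graph lies over the ball of radius `r`. -/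
structure IsGraphOver {d k : ℕ} (M : Set (E d)) (x : E d) (L : E k →ₗᵢ[ℝ] E d) (C s r : ℝ) :
    Prop where
  tangent : ∀ ρ ≤ s, ∀ y ∈ M, ∀ z ∈ M, ‖y - x‖ ≤ ρ → ‖z - x‖ ≤ ρ →
    ‖(y - z) - L (proj L (y - z))‖ ≤ C * ρ * ‖y - z‖
  surj : ∀ u : E k, ‖u‖ < r → ∃ y ∈ M, ‖y - x‖ ≤ s ∧ proj L (y - x) = u

/-- Near an interior point, `M` is the graph over its tangent plane at each of its points, with
uniform constants. The tangency is the second order expansion of a parametrization; that the graph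
covers a ball of uniform radius is the quantitative surjectivity in the inverse function theorem, applied
to the parametrization followed by the tangential projection. -/
theorem IsInteriorPt.exists_isGraphOver {d k : ℕ} (hkd : k ≤ d) {M : Set (E d)} {p : E d}
    (hp : IsInteriorPt k M p) (s₁ : ℝ) (hs₁ : 0 < s₁) :
    ∃ C s r : ℝ, 0 < C ∧ 0 < s ∧ s ≤ s₁ ∧ 0 < r ∧ 2 * r ≤ s ∧ C * s ≤ 1 / 2 ∧
      ∀ x ∈ M, ‖x - p‖ < s → ∃ L : E k →ₗᵢ[ℝ] E d, IsGraphOver M x L C s r := by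
  obtain ⟨ψ, τ, hψ, hτ, hψτ, hG, hA⟩ := hp.exists_parametrization hkd
  obtain ⟨K, t, hK, ht, hψK, hψd, hψe⟩ := exists_fderiv_expansion hψ
  obtain ⟨T, q, hT, hq, hτT, hτd, -⟩ := exists_fderiv_expansion hτ
  have hlip : ∀ y ∈ Metric.ball p q, ∀ z ∈ Metric.ball p q, ‖τ y - τ z‖ ≤ T * ‖y - z‖ :=
    fun y hy z hz =>
      (convex_ball p q).norm_image_sub_le_of_norm_fderiv_le hτd hτT hz hy
  have hψp : ∀ᶠ a in 𝓝 (τ p), ψ a ∈ Metric.ball p q :=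
    hψ.continuousAt.eventually_mem (by rw [hψτ]; exact Metric.ball_mem_nhds p hq)
  obtain ⟨t₁, ht₁, hball₁⟩ := Metric.mem_nhds_iff.1
    (inter_mem (hA.and hψp) (Metric.ball_mem_nhds (τ p) ht))
  have hG' : ∀ᶠ y in 𝓝 p, τ y ∈ Metric.ball (τ p) (t₁ / 2) :=
    hτ.continuousAt.eventually_mem (Metric.ball_mem_nhds _ (by linarith))
  obtain ⟨s₀, hs₀, hball₀⟩ := Metric.mem_nhds_iff.1
    (inter_mem (hG.and hG') (Metric.ball_mem_nhds p hq))
  -- `K` bounds the second order error of `ψ`, and `T` is a Lipschitz constant of `τ`: the slope of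
  -- the graph over the ball of radius `ρ` is at most `K * (T * ρ) * T`
  have hC : 0 < K * T ^ 2 := by positivity
  obtain ⟨s, hs, hss₁, hss₀, hsC⟩ : ∃ s : ℝ, 0 < s ∧ s ≤ s₁ ∧ 3 * s ≤ s₀ ∧
      K * T ^ 2 * s ≤ 1 / 2 := by
    refine ⟨min s₁ (min (s₀ / 3) (1 / 2 / (K * T ^ 2))), by positivity, min_le_left _ _, ?_, ?_⟩
    · have := (min_le_right s₁ _).trans (min_le_left (s₀ / 3) (1 / 2 / (K * T ^ 2)))
      linarith
    · have := (min_le_right s₁ _).trans (min_le_right (s₀ / 3) (1 / 2 / (K * T ^ 2)))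
      rw [le_div_iff₀ hC] at this
      linarith
  obtain ⟨σ, hσ, hσt, hσs, hσK⟩ : ∃ σ : ℝ, 0 < σ ∧ σ ≤ t₁ / 4 ∧ K * σ ≤ s ∧ K * σ * T ≤ 1 / 2 := by
    refine ⟨min (t₁ / 4) (min (s / K) (1 / 2 / (K * T))), by positivity, min_le_left _ _, ?_, ?_⟩
    · have := (min_le_right (t₁ / 4) _).trans (min_le_left (s / K) (1 / 2 / (K * T)))
      rw [le_div_iff₀ hK] at this
      linarith
    · have := (min_le_right (t₁ / 4) _).trans (min_le_right (s / K) (1 / 2 / (K * T)))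
      rw [le_div_iff₀ (by positivity)] at this
      linarith
  refine ⟨K * T ^ 2, s, min (σ / (2 * T)) (s / 2), hC, hs, hss₁, by positivity,
    by linarith [min_le_right (σ / (2 * T)) (s / 2)], hsC, fun x hxM hx => ?_⟩
  have hin : ∀ y, ‖y - x‖ ≤ s → y ∈ Metric.ball p s₀ := fun y hy => by
    rw [mem_ball_iff_norm]
    calc ‖y - p‖ = ‖(y - x) + (x - p)‖ := by congr 1; abel
      _ ≤ ‖y - x‖ + ‖x - p‖ := norm_add_le _ _
      _ < s₀ := by linarith
  have hxs : x ∈ Metric.ball p s₀ := hin x (by simpa using hs.le)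
  have haball : τ x ∈ Metric.ball (τ p) (t₁ / 2) := (hball₀ hxs).1.2
  have hsub : ∀ y, y ∈ Metric.ball (τ p) (t₁ / 2) → y ∈ Metric.ball (τ p) t₁ :=
    fun y hy => Metric.ball_subset_ball (by linarith) hy
  have hψx : ψ (τ x) = x := (hball₀ hxs).1.1 hxM
  -- the derivative of `ψ` at `τ x` has a left inverse, the derivative of `τ` at `x`
  have hinv : ∀ v, ‖v‖ ≤ T * ‖fderiv ℝ ψ (τ x) v‖ := fun v => by
    have hd1 := (hψd _ (hball₁ (hsub _ haball)).2).hasFDerivAt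
    have hxq : ψ (τ x) ∈ Metric.ball p q := (hball₁ (hsub _ haball)).1.2
    have hcomp := (hτd _ hxq).hasFDerivAt.comp (τ x) hd1
    have hid : (τ ∘ ψ) =ᶠ[𝓝 (τ x)] id := by
      filter_upwards [Metric.isOpen_ball.mem_nhds (hsub _ haball)] with b hb
      exact (hball₁ hb).1.1.2
    have heq := (hcomp.congr_of_eventuallyEq hid.symm).unique (hasFDerivAt_id (τ x))
    have := congrArg (fun B : E k →L[ℝ] E k => B v) heq
    simp only [ContinuousLinearMap.comp_apply, ContinuousLinearMap.id_apply] at this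
    calc ‖v‖ = ‖fderiv ℝ τ (ψ (τ x)) (fderiv ℝ ψ (τ x) v)‖ := by rw [this]
      _ ≤ ‖fderiv ℝ τ (ψ (τ x))‖ * ‖fderiv ℝ ψ (τ x) v‖ := ContinuousLinearMap.le_opNorm _ _
      _ ≤ T * ‖fderiv ℝ ψ (τ x) v‖ := by gcongr; exact hτT _ hxq
  obtain ⟨L, hL⟩ := exists_linearIsometry_range (fderiv ℝ ψ (τ x))
    ((injective_iff_map_eq_zero _).2 fun v hv => by
      have := hinv v
      rw [hv, norm_zero, mul_zero] at this
      exact norm_le_zero_iff.1 this)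
  refine ⟨L, fun ρ hρ y hy z hz hyx hzx => ?_, fun u hu => ?_⟩
  · have hys := hball₀ (hin y (hyx.trans hρ))
    have hzs := hball₀ (hin z (hzx.trans hρ))
    have hxs' := hball₀ hxs
    obtain ⟨u, hu⟩ := hL (τ y - τ z)
    have hρ0 : 0 ≤ ρ := (norm_nonneg _).trans hyx
    have h1 := hψe (τ x) (hball₁ (hsub _ haball)).2 (τ y) (hball₁ (hsub _ hys.1.2)).2 (τ z)
      (hball₁ (hsub _ hzs.1.2)).2 (T * ρ)
      ((hlip y hys.2 x hxs'.2).trans (by gcongr)) ((hlip z hzs.2 x hxs'.2).trans (by gcongr))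
    rw [hys.1.1 hy, hzs.1.1 hz, hu] at h1
    calc _ ≤ ‖y - z - L u‖ := norm_sub_proj_le L _ u
      _ ≤ K * (T * ρ) * ‖τ y - τ z‖ := h1
      _ ≤ K * (T * ρ) * (T * ‖y - z‖) := by gcongr; exact hlip y hys.2 z hzs.2
      _ = _ := by ring
  · let A : E k →L[ℝ] E k := (proj L).comp (fderiv ℝ ψ (τ x))
    have hAv : ∀ v, ‖v‖ ≤ T * ‖A v‖ := fun v => by
      obtain ⟨w, hw⟩ := hL v
      have h1 := hinv v
      simp only [A, ContinuousLinearMap.comp_apply, hw, proj_apply_self]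
      rwa [hw, L.norm_map] at h1
    have hAinj : Function.Injective A.toLinearMap := (injective_iff_map_eq_zero _).2 fun v hv => by
      have h1 := hAv v
      change A v = 0 at hv
      rw [hv, norm_zero, mul_zero] at h1
      exact norm_le_zero_iff.1 h1
    have hAsurj : Function.Surjective A := LinearMap.injective_iff_surjective.1 hAinj
    -- `A` is invertible with inverse of norm at most `T`, and the projected parametrization is
    -- within `K * σ ≤ T⁻¹ / 2` of it, so it covers a ball of radius `σ / (2 * T)`
    let S : A.NonlinearRightInverse :=
      { toFun := Function.surjInv hAsurj
        nnnorm := ⟨T, hT.le⟩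
        bound' := fun y => by
          have := hAv (Function.surjInv hAsurj y)
          rwa [Function.surjInv_eq hAsurj] at this
        right_inv' := Function.surjInv_eq hAsurj }
    have hcb : ∀ b, b ∈ Metric.closedBall (τ x) σ → b ∈ Metric.ball (τ p) t₁ := fun b hb => by
      rw [Metric.mem_closedBall] at hb
      rw [Metric.mem_ball] at haball ⊢
      linarith [dist_triangle b (τ x) (τ p)]
    have happ : ApproximatesLinearOn (fun b => proj L (ψ b)) A (Metric.closedBall (τ x) σ)
        ⟨K * σ, by positivity⟩ := by
      intro b hb c hc
      have h1 := hψe (τ x) (hball₁ (hsub _ haball)).2 b (hball₁ (hcb b hb)).2 c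
        (hball₁ (hcb c hc)).2 σ (mem_closedBall_iff_norm.1 hb) (mem_closedBall_iff_norm.1 hc)
      rw [← map_sub]
      refine le_trans ?_ h1
      simp only [A, ContinuousLinearMap.comp_apply]
      rw [← map_sub]
      exact norm_proj_le L _
    have hr : σ / (2 * T) ≤ (T⁻¹ - K * σ) * σ := by
      have h3 : K * σ ≤ 1 / 2 * T⁻¹ := by
        rw [← div_eq_mul_inv, le_div_iff₀ hT]; exact hσK
      calc σ / (2 * T) = (T⁻¹ - 1 / 2 * T⁻¹) * σ := by field_simp; norm_num
        _ ≤ _ := by gcongr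
    obtain ⟨b, hb, hbu⟩ := happ.surjOn_closedBall_of_nonlinearRightInverse S hσ.le subset_rfl
      (show proj L (ψ (τ x)) + u ∈ _ by
        rw [mem_closedBall_iff_norm, add_sub_cancel_left]
        exact (hu.le.trans (min_le_left _ _)).trans hr)
    refine ⟨ψ b, (hball₁ (hcb b hb)).1.1.1, ?_, ?_⟩
    · have := (convex_closedBall (τ x) σ).norm_image_sub_le_of_norm_fderiv_le (f := ψ)
        (fun z hz => hψd z (hball₁ (hcb z hz)).2) (fun z hz => hψK z (hball₁ (hcb z hz)).2)
        (Metric.mem_closedBall_self hσ.le) hb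
      rw [hψx] at this
      rw [mem_closedBall_iff_norm] at hb
      exact (this.trans (by gcongr)).trans hσs
    · simp only [hψx] at hbu
      rw [map_sub, hbu, add_sub_cancel_left]

/-! ### The volume measure in the tangent plane -/

theorem _root_.LipschitzOnWith.euclideanHausdorffMeasure_image_le {X Y : Type*} [EMetricSpace X]
    [MeasurableSpace X] [BorelSpace X] [EMetricSpace Y] [MeasurableSpace Y] [BorelSpace Y]
    {K : NNReal} {f : X → Y} {s : Set X} (hf : LipschitzOnWith K f s) (k : ℕ) :
    Measure.euclideanHausdorffMeasure k (f '' s) ≤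
      (K : ℝ≥0∞) ^ k * Measure.euclideanHausdorffMeasure k s := by
  have := hf.hausdorffMeasure_image_le (d := k) (Nat.cast_nonneg k)
  simp only [Measure.euclideanHausdorffMeasure_def, Measure.smul_apply, ENNReal.smul_def,
    smul_eq_mul]
  rw [mul_left_comm]
  gcongr
  simpa using this

theorem one_add_pow_le {q : ℝ} (hq : 0 ≤ q) (hq1 : q ≤ 1) (k : ℕ) :
    (1 + q) ^ k ≤ 1 + (2 ^ k - 1) * q := by
  induction k with
  | zero => simp
  | succ k ih =>
    have h2 : (1 : ℝ) ≤ 2 ^ k := one_le_pow₀ (by norm_num)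
    calc (1 + q) ^ (k + 1) = (1 + q) ^ k * (1 + q) := pow_succ _ _
      _ ≤ (1 + (2 ^ k - 1) * q) * (1 + q) := by gcongr
      _ ≤ _ := by
        rw [pow_succ]
        nlinarith [mul_nonneg (sub_nonneg.2 h2) (mul_nonneg hq (sub_nonneg.2 hq1))]

/-- The part of `M` near `x` that lies over the ball of radius `r` in the plane `L`. -/
def graphPiece {d k : ℕ} (M : Set (E d)) (x : E d) (L : E k →ₗᵢ[ℝ] E d) (s r : ℝ) : Set (E d) :=
  M ∩ (Metric.closedBall x s ∩ {y | ‖proj L (y - x)‖ < r})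

theorem continuous_proj_sub {d k : ℕ} (x : E d) (L : E k →ₗᵢ[ℝ] E d) :
    Continuous fun y => proj L (y - x) := by fun_prop

theorem measurableSet_graphPiece {d k : ℕ} {M : Set (E d)} (hM : MeasurableSet M) (x : E d)
    (L : E k →ₗᵢ[ℝ] E d) (s r : ℝ) : MeasurableSet (graphPiece M x L s r) :=
  hM.inter (Metric.isClosed_closedBall.measurableSet.inter
    (isOpen_lt (continuous_proj_sub x L).norm continuous_const).measurableSet)

namespace IsGraphOver
variable {d k : ℕ} {M : Set (E d)} {x : E d} {L : E k →ₗᵢ[ℝ] E d} {C s r : ℝ}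

/-- The slope of the graph is at most `1 / 2`, hence distances to `x` are comparable to those of
the projections. -/
theorem norm_sub_le (hg : IsGraphOver M x L C s r) (hx : x ∈ M) (hCs : C * s ≤ 1 / 2)
    {y : E d} (hy : y ∈ M) (hys : ‖y - x‖ ≤ s) : ‖y - x‖ ≤ 2 * ‖proj L (y - x)‖ := by
  have h1 := hg.tangent s le_rfl y hy x hx hys (by simpa using (norm_nonneg _).trans hys)
  have h2 := norm_sq_eq_proj L (y - x)
  have h3 : ‖y - x - L (proj L (y - x))‖ ≤ 1 / 2 * ‖y - x‖ :=
    h1.trans (by gcongr)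
  have h4 : ‖y - x - L (proj L (y - x))‖ ^ 2 ≤ (1 / 2 * ‖y - x‖) ^ 2 := by gcongr
  refine le_of_sq_le_sq ?_ (by positivity)
  nlinarith [norm_nonneg (proj L (y - x))]

/-- The distance from the tangent plane is of second order. -/
theorem norm_normal_le (hg : IsGraphOver M x L C s r) (hC : 0 ≤ C) (hx : x ∈ M)
    (hCs : C * s ≤ 1 / 2) {y : E d} (hy : y ∈ M) (hys : ‖y - x‖ ≤ s) :
    ‖y - x - L (proj L (y - x))‖ ≤ 4 * C * ‖proj L (y - x)‖ ^ 2 := by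
  have h1 := hg.tangent ‖y - x‖ hys y hy x hx le_rfl (by simp)
  have h2 := hg.norm_sub_le hx hCs hy hys
  calc _ ≤ C * ‖y - x‖ * ‖y - x‖ := h1
    _ ≤ C * (2 * ‖proj L (y - x)‖) * (2 * ‖proj L (y - x)‖) := by gcongr
    _ = _ := by ring

/-- Over the ball of radius `ρ`, the map from the tangent plane to the graph is Lipschitz with
constant `1 + O(ρ²)`: the slope is `O(ρ)`, and enters squared by Pythagoras. -/
theorem norm_sub_le_of_proj_le (hg : IsGraphOver M x L C s r) (hC : 0 ≤ C) (hx : x ∈ M)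
    (hCs : C * s ≤ 1 / 2) {ρ : ℝ} (hρ : 2 * ρ ≤ s) {y z : E d} (hy : y ∈ M) (hz : z ∈ M)
    (hys : ‖y - x‖ ≤ s) (hzs : ‖z - x‖ ≤ s) (hyρ : ‖proj L (y - x)‖ ≤ ρ)
    (hzρ : ‖proj L (z - x)‖ ≤ ρ) :
    ‖y - z‖ ≤ (1 + 4 * C ^ 2 * ρ ^ 2) * ‖proj L (y - x) - proj L (z - x)‖ := by
  have hρ0 : 0 ≤ ρ := (norm_nonneg _).trans hyρ
  have h1 := hg.tangent (2 * ρ) hρ y hy z hz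
    ((hg.norm_sub_le hx hCs hy hys).trans (by gcongr))
    ((hg.norm_sub_le hx hCs hz hzs).trans (by gcongr))
  have h2 := norm_sq_eq_proj L (y - z)
  have h3 : proj L (y - x) - proj L (z - x) = proj L (y - z) := by
    rw [← map_sub]; congr 1; abel
  rw [h3]
  have hCρ : C * (2 * ρ) ≤ 1 / 2 := le_trans (by gcongr) hCs
  have hq : 4 * C ^ 2 * ρ ^ 2 = (C * (2 * ρ)) ^ 2 := by ring
  rw [hq]
  have hc0 : 0 ≤ C * (2 * ρ) := by positivity
  set q := (C * (2 * ρ)) ^ 2 with hqdef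
  have hq1 : q ≤ 1 / 4 := by nlinarith
  have hq0 : 0 ≤ q := sq_nonneg _
  have h4 : ‖y - z - L (proj L (y - z))‖ ^ 2 ≤ q * ‖y - z‖ ^ 2 := by
    rw [hqdef, ← mul_pow]; gcongr
  refine le_of_sq_le_sq ?_ (by positivity)
  have h5 : (1 - q) * ‖y - z‖ ^ 2 ≤ ‖proj L (y - z)‖ ^ 2 := by linarith
  have h6 : 1 ≤ (1 + q) ^ 2 * (1 - q) := by nlinarith [mul_nonneg hq0 hq0]
  calc ‖y - z‖ ^ 2 = 1 * ‖y - z‖ ^ 2 := (one_mul _).symm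
    _ ≤ (1 + q) ^ 2 * (1 - q) * ‖y - z‖ ^ 2 := by gcongr
    _ = (1 + q) ^ 2 * ((1 - q) * ‖y - z‖ ^ 2) := by ring
    _ ≤ (1 + q) ^ 2 * ‖proj L (y - z)‖ ^ 2 := by gcongr
    _ = _ := by ring

/-- The volume of the part of `M` over a subset of the ball of radius `ρ` exceeds that of the subset
by a factor at most `1 + O(ρ²)`, as the graph map is Lipschitz. -/
theorem measure_le_of_norm_le (hg : IsGraphOver M x L C s r) (hC : 0 ≤ C) (hx : x ∈ M)
    (hCs : C * s ≤ 1 / 2) (hrs : 2 * r ≤ s) {ρ : ℝ} (hρr : ρ ≤ r) {B : Set (E k)}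
    (hBr : ∀ u ∈ B, ‖u‖ < r) (hBρ : ∀ u ∈ B, ‖u‖ ≤ ρ) :
    Measure.euclideanHausdorffMeasure k ((fun y => proj L (y - x)) ⁻¹' B ∩ graphPiece M x L s r) ≤
      ENNReal.ofReal ((1 + 4 * C ^ 2 * ρ ^ 2) ^ k) * volume B := by
  choose! G hGM hGs hGp using hg.surj
  have hinj : (fun y => proj L (y - x)) ⁻¹' B ∩ graphPiece M x L s r ⊆ G '' B := by
    rintro y ⟨hyB, hyM, hys, hyr⟩
    refine ⟨_, hyB, ?_⟩
    have h1 := hg.norm_sub_le_of_proj_le hC hx hCs hrs hyM (hGM _ hyr)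
      (mem_closedBall_iff_norm.1 hys) (hGs _ hyr) (le_of_lt hyr)
      (by rw [hGp _ hyr]; exact le_of_lt hyr)
    rw [hGp _ hyr, sub_self, norm_zero, mul_zero] at h1
    exact (sub_eq_zero.1 (norm_le_zero_iff.1 h1)).symm
  have hlip : LipschitzOnWith ⟨1 + 4 * C ^ 2 * ρ ^ 2, by positivity⟩ G B :=
    LipschitzOnWith.of_dist_le_mul fun u hu v hv => by
      rw [dist_eq_norm, dist_eq_norm]
      have h1 := hg.norm_sub_le_of_proj_le hC hx hCs (ρ := ρ) (by linarith) (hGM u (hBr u hu))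
        (hGM v (hBr v hv)) (hGs u (hBr u hu)) (hGs v (hBr v hv))
        (by rw [hGp u (hBr u hu)]; exact hBρ u hu) (by rw [hGp v (hBr v hv)]; exact hBρ v hv)
      rwa [hGp u (hBr u hu), hGp v (hBr v hv)] at h1
  refine (measure_mono hinj).trans ((hlip.euclideanHausdorffMeasure_image_le k).trans_eq ?_)
  rw [EuclideanSpace.euclideanHausdorffMeasure_eq_volume, ENNReal.ofReal_pow (by positivity)]
  congr 2
  exact (ENNReal.ofReal_eq_coe_nnreal _).symm

/-- The projection to the tangent plane is `1`-Lipschitz, so it does not increase volumes. -/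
theorem volume_le_measure (hg : IsGraphOver M x L C s r) {B : Set (E k)}
    (hBr : ∀ u ∈ B, ‖u‖ < r) :
    volume B ≤ Measure.euclideanHausdorffMeasure k
      ((fun y => proj L (y - x)) ⁻¹' B ∩ graphPiece M x L s r) := by
  have hsub : B ⊆ (fun y => proj L (y - x)) ''
      ((fun y => proj L (y - x)) ⁻¹' B ∩ graphPiece M x L s r) := fun u hu => by
    obtain ⟨y, hy, hys, rfl⟩ := hg.surj u (hBr u hu)
    exact ⟨y, ⟨hu, hy, mem_closedBall_iff_norm.2 hys, hBr _ hu⟩, rfl⟩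
  have hlip : LipschitzWith 1 fun y => proj L (y - x) :=
    LipschitzWith.of_dist_le_mul fun y z => by
      rw [dist_eq_norm, dist_eq_norm, ← map_sub, sub_sub_sub_cancel_right, NNReal.coe_one, one_mul]
      exact norm_proj_le L _
  rw [← EuclideanSpace.euclideanHausdorffMeasure_eq_volume]
  refine (measure_mono hsub).trans ?_
  simpa using (hlip.lipschitzOnWith (s := ((fun y => proj L (y - x)) ⁻¹' B ∩
    graphPiece M x L s r))).euclideanHausdorffMeasure_image_le k

theorem map_apply_eq {B : Set (E k)} (hB : MeasurableSet B) :
    (((Measure.euclideanHausdorffMeasure k).restrict (graphPiece M x L s r)).map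
      fun y => proj L (y - x)) B = Measure.euclideanHausdorffMeasure k
      ((fun y => proj L (y - x)) ⁻¹' B ∩ graphPiece M x L s r) := by
  rw [Measure.map_apply (continuous_proj_sub x L).measurable hB,
    Measure.restrict_apply ((continuous_proj_sub x L).measurable hB)]

/-- The bound `1 + O(ρ²)` on the ball of radius `ρ`, applied on dyadic shells, gives the density
bound `1 + O(‖u‖²)`. -/
theorem map_le_withDensity (hg : IsGraphOver M x L C s r) (hC : 0 ≤ C) (hx : x ∈ M)
    (hr : 0 < r) (hCs : C * s ≤ 1 / 2) (hrs : 2 * r ≤ s) :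
    (((Measure.euclideanHausdorffMeasure k).restrict (graphPiece M x L s r)).map
      fun y => proj L (y - x)) ≤ (volume.restrict (Metric.ball (0 : E k) r)).withDensity
        fun u => ENNReal.ofReal (1 + 2 ^ k * 16 * C ^ 2 * ‖u‖ ^ 2) := by
  set μ := ((Measure.euclideanHausdorffMeasure k).restrict (graphPiece M x L s r)).map
      fun y => proj L (y - x) with hμ
  set ν := (volume.restrict (Metric.ball (0 : E k) r)).withDensity
        fun u => ENNReal.ofReal (1 + 2 ^ k * 16 * C ^ 2 * ‖u‖ ^ 2) with hν
  -- on a shell, the density is constant up to the factor `4` in the quadratic term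
  have hshell : ∀ B : Set (E k), MeasurableSet B → ∀ ρ, 0 ≤ ρ →
      (∀ u ∈ B, ‖u‖ ≤ ρ ∧ ρ ≤ 2 * ‖u‖) → μ B ≤ ν B := fun B hB ρ hρ hBρ => by
    have hout : μ B = Measure.euclideanHausdorffMeasure k
        ((fun y => proj L (y - x)) ⁻¹' (B ∩ Metric.ball 0 r) ∩ graphPiece M x L s r) := by
      rw [hμ, map_apply_eq hB]
      congr 1
      ext y
      simp only [mem_inter_iff, mem_preimage, mem_ball_zero_iff]
      exact ⟨fun h => ⟨⟨h.1, h.2.2.2⟩, h.2⟩, fun h => ⟨h.1.1, h.2⟩⟩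
    rw [hout]
    refine (hg.measure_le_of_norm_le hC hx hCs hrs (min_le_right ρ r)
      (fun u hu => mem_ball_zero_iff.1 hu.2) fun u hu => le_min (hBρ u hu.1).1
      (mem_ball_zero_iff.1 hu.2).le).trans ?_
    rw [hν, withDensity_apply _ hB, Measure.restrict_restrict hB, ← setLIntegral_const]
    refine setLIntegral_mono' (hB.inter measurableSet_ball) fun u hu => ENNReal.ofReal_le_ofReal ?_
    have h2 : min ρ r ≤ 2 * ‖u‖ := (min_le_left _ _).trans (hBρ u hu.1).2
    have h0 : 0 ≤ min ρ r := le_min hρ hr.le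
    -- `ρ ≤ 2 * ‖u‖` turns the factor `4 * C ^ 2 * ρ ^ 2` into `16 * C ^ 2 * ‖u‖ ^ 2`
    have hCm : C * (2 * min ρ r) ≤ 1 / 2 :=
      le_trans (by gcongr; linarith [min_le_right ρ r]) hCs
    have hCm0 : 0 ≤ C * (2 * min ρ r) := by positivity
    have hq1 : 4 * C ^ 2 * min ρ r ^ 2 ≤ 1 := by nlinarith
    have h2k : (0 : ℝ) ≤ 2 ^ k - 1 := sub_nonneg.2 (one_le_pow₀ (by norm_num))
    calc (1 + 4 * C ^ 2 * min ρ r ^ 2) ^ k ≤ 1 + (2 ^ k - 1) * (4 * C ^ 2 * min ρ r ^ 2) :=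
          one_add_pow_le (by positivity) hq1 k
      _ ≤ 1 + 2 ^ k * (4 * C ^ 2 * (2 * ‖u‖) ^ 2) := by gcongr; linarith
      _ = _ := by ring
  -- the origin is a shell of its own: it is not negligible in dimension `k = 0`
  let S : Option ℤ → Set (E k) := fun o =>
    o.elim {0} fun n => {u | (2 : ℝ) ^ n ≤ ‖u‖ ∧ ‖u‖ < 2 ^ (n + 1)}
  have hSm : ∀ o, MeasurableSet (S o) := by
    rintro (_ | n)
    · exact measurableSet_singleton 0
    · exact (measurableSet_le measurable_const measurable_norm).inter
        (measurableSet_lt measurable_norm measurable_const)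
  have hSd : Pairwise (Function.onFun Disjoint S) := by
    have h0 : ∀ n, Disjoint (S none) (S (some n)) := fun n => by
      refine Set.disjoint_left.2 fun u hu hu' => ?_
      obtain rfl : u = 0 := hu
      have h1 : (2 : ℝ) ^ n ≤ ‖(0 : E k)‖ := hu'.1
      rw [norm_zero] at h1
      exact absurd h1 (not_le.2 (by positivity))
    rintro (_ | m) (_ | n) hmn
    · exact absurd rfl hmn
    · exact h0 n
    · exact (h0 m).symm
    · refine Set.disjoint_left.2 fun u hu hu' => hmn ?_
      have h1 : m < n + 1 := (zpow_lt_zpow_iff_right₀ (one_lt_two (α := ℝ))).1 (hu.1.trans_lt hu'.2)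
      have h2 : n < m + 1 := (zpow_lt_zpow_iff_right₀ (one_lt_two (α := ℝ))).1 (hu'.1.trans_lt hu.2)
      congr 1
      lia
  have hSu : ⋃ o, S o = univ := by
    refine eq_univ_of_forall fun u => mem_iUnion.2 ?_
    rcases eq_or_ne u 0 with rfl | hu
    · exact ⟨none, rfl⟩
    · obtain ⟨n, hn⟩ := exists_mem_Ico_zpow (norm_pos_iff.2 hu) (one_lt_two (α := ℝ))
      exact ⟨some n, hn⟩
  refine Measure.le_iff.2 fun B hB => ?_
  have hBu : B = ⋃ o, B ∩ S o := by rw [← inter_iUnion, hSu, inter_univ]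
  have hdisj : Pairwise (Function.onFun Disjoint fun o => B ∩ S o) := fun i j hij =>
    (hSd hij).mono inter_subset_right inter_subset_right
  rw [hBu, measure_iUnion hdisj fun o => hB.inter (hSm o),
    measure_iUnion hdisj fun o => hB.inter (hSm o)]
  refine ENNReal.tsum_le_tsum ?_
  rintro (_ | n)
  · refine hshell _ (hB.inter (hSm _)) 0 le_rfl fun u hu => ?_
    obtain rfl : u = 0 := hu.2
    simp
  · refine hshell _ (hB.inter (hSm _)) (2 ^ (n + 1)) (by positivity) fun u hu => ⟨hu.2.2.le, ?_⟩
    rw [zpow_add_one₀ two_ne_zero, mul_comm]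
    exact mul_le_mul_of_nonneg_left hu.2.1 zero_le_two

/-- The Riemannian volume of `M` near `x`, read in the tangent plane, is the Lebesgue measure up to
a second order term. -/
theorem exists_map_eq_add (hg : IsGraphOver M x L C s r) (hC : 0 ≤ C) (hx : x ∈ M)
    (hr : 0 < r) (hCs : C * s ≤ 1 / 2) (hrs : 2 * r ≤ s) :
    ∃ ν : Measure (E k), (((Measure.euclideanHausdorffMeasure k).restrict
      (graphPiece M x L s r)).map fun y => proj L (y - x)) =
        ν + volume.restrict (Metric.ball (0 : E k) r) ∧
      ν ≤ (volume.restrict (Metric.ball (0 : E k) r)).withDensity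
        fun u => ENNReal.ofReal (2 ^ k * 16 * C ^ 2 * ‖u‖ ^ 2) := by
  have hle : volume.restrict (Metric.ball (0 : E k) r) ≤
      ((Measure.euclideanHausdorffMeasure k).restrict
        (graphPiece M x L s r)).map fun y => proj L (y - x) := by
    refine Measure.le_iff.2 fun B hB => ?_
    rw [map_apply_eq hB, Measure.restrict_apply hB]
    exact (hg.volume_le_measure fun u hu => mem_ball_zero_iff.1 hu.2).trans
      (measure_mono (inter_subset_inter_left _ (preimage_mono inter_subset_left)))
  have : IsFiniteMeasure (volume.restrict (Metric.ball (0 : E k) r)) :=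
    ⟨by simpa using measure_ball_lt_top⟩
  refine ⟨_, (Measure.sub_add_cancel_of_le hle).symm, Measure.sub_le_of_le_add ?_⟩
  refine (hg.map_le_withDensity hC hx hr hCs hrs).trans_eq ?_
  have h1 : (fun u : E k => ENNReal.ofReal (1 + 2 ^ k * 16 * C ^ 2 * ‖u‖ ^ 2)) =
      1 + fun u => ENNReal.ofReal (2 ^ k * 16 * C ^ 2 * ‖u‖ ^ 2) := by
    ext u
    rw [Pi.add_apply, Pi.one_apply, ENNReal.ofReal_add zero_le_one (by positivity),
      ENNReal.ofReal_one]
  rw [h1, withDensity_add_left measurable_one, withDensity_one, add_comm]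

end IsGraphOver

/-! ### Gaussian bounds -/

theorem mul_exp_neg_le (t : ℝ) : t * Real.exp (-t) ≤ 2 * Real.exp (-(t / 2)) := by
  have h1 : t / 2 ≤ Real.exp (t / 2) := by linarith [Real.add_one_le_exp (t / 2)]
  have h2 : Real.exp (-t) = Real.exp (-(t / 2)) * Real.exp (-(t / 2)) := by
    rw [← Real.exp_add]; ring_nf
  have h3 : Real.exp (t / 2) * Real.exp (-(t / 2)) = 1 := by
    rw [← Real.exp_add]; simp
  calc t * Real.exp (-t) = 2 * (t / 2 * Real.exp (-(t / 2))) * Real.exp (-(t / 2)) := by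
        rw [h2]; ring
    _ ≤ 2 * (Real.exp (t / 2) * Real.exp (-(t / 2))) * Real.exp (-(t / 2)) := by gcongr
    _ = _ := by rw [h3, mul_one]

theorem sq_mul_exp_neg_le {t : ℝ} (ht : 0 ≤ t) :
    t ^ 2 * Real.exp (-t) ≤ 8 * Real.exp (-(t / 2)) := by
  have h1 : (t / 2) ^ 2 / 2 ≤ Real.exp (t / 2) := by
    simpa using Real.pow_div_factorial_le_exp (t / 2) (by positivity) 2
  have h2 : Real.exp (-t) = Real.exp (-(t / 2)) * Real.exp (-(t / 2)) := by
    rw [← Real.exp_add]; ring_nf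
  have h3 : Real.exp (t / 2) * Real.exp (-(t / 2)) = 1 := by
    rw [← Real.exp_add]; simp
  calc t ^ 2 * Real.exp (-t)
      = 8 * ((t / 2) ^ 2 / 2 * Real.exp (-(t / 2))) * Real.exp (-(t / 2)) := by
        rw [h2]; ring
    _ ≤ 8 * (Real.exp (t / 2) * Real.exp (-(t / 2))) * Real.exp (-(t / 2)) := by gcongr
    _ = _ := by rw [h3, mul_one]

theorem sq_mul_gauss_le {a h : ℝ} (hh : 0 < h) :
    a ^ 2 * Real.exp (-(a ^ 2 / h ^ 2)) ≤ 2 * h ^ 2 * Real.exp (-(a ^ 2 / h ^ 2 / 2)) := by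
  have := mul_exp_neg_le (a ^ 2 / h ^ 2)
  calc a ^ 2 * Real.exp (-(a ^ 2 / h ^ 2))
      = h ^ 2 * (a ^ 2 / h ^ 2 * Real.exp (-(a ^ 2 / h ^ 2))) := by field_simp
    _ ≤ h ^ 2 * (2 * Real.exp (-(a ^ 2 / h ^ 2 / 2))) := by gcongr
    _ = _ := by ring

theorem pow_four_mul_gauss_le {a h : ℝ} (hh : 0 < h) :
    a ^ 4 * Real.exp (-(a ^ 2 / h ^ 2)) ≤ 8 * h ^ 4 * Real.exp (-(a ^ 2 / h ^ 2 / 2)) := by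
  have := sq_mul_exp_neg_le (t := a ^ 2 / h ^ 2) (by positivity)
  calc a ^ 4 * Real.exp (-(a ^ 2 / h ^ 2))
      = h ^ 4 * ((a ^ 2 / h ^ 2) ^ 2 * Real.exp (-(a ^ 2 / h ^ 2))) := by field_simp
    _ ≤ h ^ 4 * (8 * Real.exp (-(a ^ 2 / h ^ 2 / 2))) := by gcongr
    _ = _ := by ring

theorem gauss_le_gauss_half (t : ℝ) (ht : 0 ≤ t) : Real.exp (-t) ≤ Real.exp (-(t / 2)) :=
  Real.exp_le_exp.2 (by linarith)

theorem integral_gauss {k : ℕ} {b h : ℝ} (hb : 0 < b) (hh : 0 < h) :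
    ∫ u : E k, Real.exp (-(‖u‖ ^ 2 / h ^ 2 / b)) = (b * Real.pi) ^ ((k : ℝ) / 2) * h ^ k := by
  have h1 := GaussianFourier.integral_rexp_neg_mul_sq_norm (V := E k) (b := 1 / (h ^ 2 * b))
    (by positivity)
  have h2 : (fun u : E k => Real.exp (-(‖u‖ ^ 2 / h ^ 2 / b))) =
      fun u => Real.exp (-(1 / (h ^ 2 * b)) * ‖u‖ ^ 2) := by
    ext u; congr 1; field_simp
  rw [h2, h1]
  have h3 : Real.pi / (1 / (h ^ 2 * b)) = (b * Real.pi) * h ^ 2 := by field_simp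
  rw [h3, Real.mul_rpow (by positivity) (by positivity), finrank_euclideanSpace_fin]
  congr 1
  rw [← Real.rpow_natCast, ← Real.rpow_mul hh.le, ← Real.rpow_natCast]
  congr 1
  push_cast
  ring

theorem integrable_gauss {k : ℕ} {b h : ℝ} (hb : 0 < b) (hh : 0 < h) :
    Integrable fun u : E k => Real.exp (-(‖u‖ ^ 2 / h ^ 2 / b)) := by
  -- a non-integrable function would have integral zero
  by_contra hn
  have h1 := integral_undef hn
  rw [integral_gauss hb hh] at h1
  have : 0 < (b * Real.pi) ^ ((k : ℝ) / 2) * h ^ k := by positivity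
  exact this.ne' h1

/-! ### Gaussian integrals in the tangent plane -/

section Tangent
variable {k : ℕ} {D F r h : ℝ} {ν : Measure (E k)}

theorem isFiniteMeasure_of_le_withDensity
    (hν : ν ≤ (volume.restrict (Metric.ball (0 : E k) r)).withDensity
    fun u => ENNReal.ofReal (D * ‖u‖ ^ 2)) : IsFiniteMeasure ν := by
  have h1 : IntegrableOn (fun u : E k => D * ‖u‖ ^ 2) (Metric.ball 0 r) volume :=
    ((by fun_prop : Continuous fun u : E k => D * ‖u‖ ^ 2).locallyIntegrable.integrableOn_isCompact
      (isCompact_closedBall 0 r)).mono_set Metric.ball_subset_closedBall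
  have := isFiniteMeasure_withDensity_ofReal h1.2
  exact isFiniteMeasure_of_le _ hν

theorem integral_le_of_le (hD : 0 ≤ D)
    (hν : ν ≤ (volume.restrict (Metric.ball (0 : E k) r)).withDensity
      fun u => ENNReal.ofReal (D * ‖u‖ ^ 2)) {φ : E k → ℝ} (hφ : Continuous φ) {B : ℝ}
    (hφ0 : ∀ u, 0 ≤ φ u) (hφB : ∀ u, φ u ≤ B) :
    ∫ u, φ u ∂ν ≤ ∫ u in Metric.ball (0 : E k) r, D * ‖u‖ ^ 2 * φ u := by
  have := isFiniteMeasure_of_le_withDensity (le_refl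
    ((volume.restrict (Metric.ball (0 : E k) r)).withDensity
      fun u => ENNReal.ofReal (D * ‖u‖ ^ 2)))
  have hint : Integrable φ ((volume.restrict (Metric.ball (0 : E k) r)).withDensity
      fun u => ENNReal.ofReal (D * ‖u‖ ^ 2)) :=
    Integrable.of_bound hφ.aestronglyMeasurable B (ae_of_all _ fun u => by
      rw [Real.norm_of_nonneg (hφ0 u)]; exact hφB u)
  refine (integral_mono_measure hν (ae_of_all _ hφ0) hint).trans_eq ?_
  rw [integral_withDensity_eq_integral_toReal_smul (by fun_prop) (ae_of_all _ fun u => by simp)]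
  refine integral_congr_ae (ae_of_all _ fun u => ?_)
  simp only [smul_eq_mul]
  rw [ENNReal.toReal_ofReal (by positivity)]

/-- The wider Gaussian `exp (-‖u‖² / (2h²))`, which dominates every error term, has integral
`O(h^k)`. -/
theorem integral_gauss_half_le (hD : 0 ≤ D) (hh : 0 < h)
    (hν : ν ≤ (volume.restrict (Metric.ball (0 : E k) r)).withDensity
      fun u => ENNReal.ofReal (D * ‖u‖ ^ 2)) :
    ∫ u, Real.exp (-(‖u‖ ^ 2 / h ^ 2 / 2)) ∂(ν + volume.restrict (Metric.ball (0 : E k) r)) ≤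
      (1 + D * r ^ 2) * (2 * Real.pi) ^ ((k : ℝ) / 2) * h ^ k := by
  have := isFiniteMeasure_of_le_withDensity hν
  have hΓ := integrable_gauss (k := k) two_pos hh
  have hc : Continuous fun u : E k => Real.exp (-(‖u‖ ^ 2 / h ^ 2 / 2)) := by fun_prop
  have h1 : ∀ u : E k, Real.exp (-(‖u‖ ^ 2 / h ^ 2 / 2)) ≤ 1 := fun u =>
    Real.exp_le_one_iff.2 (by simp only [Left.neg_nonpos_iff]; positivity)
  rw [integral_add_measure (Integrable.of_bound hc.aestronglyMeasurable 1 (ae_of_all _ fun u => by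
      rw [Real.norm_of_nonneg (by positivity)]; exact h1 u)) hΓ.integrableOn]
  have h2 : ∫ u in Metric.ball (0 : E k) r, Real.exp (-(‖u‖ ^ 2 / h ^ 2 / 2)) ≤
      (2 * Real.pi) ^ ((k : ℝ) / 2) * h ^ k := by
    rw [← integral_gauss two_pos hh]
    exact setIntegral_le_integral hΓ (ae_of_all _ fun u => by positivity)
  have h3 : ∫ u, Real.exp (-(‖u‖ ^ 2 / h ^ 2 / 2)) ∂ν ≤
      ∫ u in Metric.ball (0 : E k) r, D * r ^ 2 * Real.exp (-(‖u‖ ^ 2 / h ^ 2 / 2)) := by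
    refine (integral_le_of_le hD hν hc (fun u => by positivity) h1).trans ?_
    refine integral_mono_of_nonneg (ae_of_all _ fun u => by positivity)
      (hΓ.const_mul _).integrableOn ?_
    filter_upwards [ae_restrict_mem measurableSet_ball] with u hu
    have := (mem_ball_zero_iff.1 hu).le
    gcongr
  rw [integral_const_mul] at h3
  have h4 : 0 ≤ D * r ^ 2 := by positivity
  nlinarith

/-- The linear part of the density cancels, as the ball and the Gaussian are symmetric. -/
theorem setIntegral_ball_odd (w : E k →L[ℝ] ℝ) :
    ∫ u in Metric.ball (0 : E k) r, Real.exp (-(‖u‖ ^ 2 / h ^ 2)) * w u = 0 := by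
  rw [← integral_indicator measurableSet_ball]
  set φ := (Metric.ball (0 : E k) r).indicator fun u => Real.exp (-(‖u‖ ^ 2 / h ^ 2)) * w u with hφ
  have h1 : ∀ u, φ (-u) = -φ u := fun u => by
    by_cases hu : u ∈ Metric.ball (0 : E k) r
    · have hu' : -u ∈ Metric.ball (0 : E k) r := by simpa using hu
      simp [hφ, indicator_of_mem hu, indicator_of_mem hu']
    · have hu' : -u ∉ Metric.ball (0 : E k) r := by simpa using hu
      simp [hφ, indicator_of_notMem hu, indicator_of_notMem hu']
  have h2 := integral_neg_eq_self φ volume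
  simp only [h1, integral_neg] at h2
  linarith

/-- The Gaussian average of an affine function in the tangent plane is its value at the centre, up
to a second order term; the linear part contributes nothing by symmetry. -/
theorem abs_integral_gauss_affine_sub_le (hD : 0 ≤ D) (hr : 0 < r) (hh : 0 < h) (hh1 : h ≤ 1)
    (hν : ν ≤ (volume.restrict (Metric.ball (0 : E k) r)).withDensity
      fun u => ENNReal.ofReal (D * ‖u‖ ^ 2)) {c : ℝ} {w : E k →L[ℝ] ℝ} (hc : |c| ≤ F)
    (hw : ‖w‖ ≤ F) :
    Integrable (fun u => Real.exp (-(‖u‖ ^ 2 / h ^ 2)) * (c + w u))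
      (ν + volume.restrict (Metric.ball (0 : E k) r)) ∧
    |∫ u, Real.exp (-(‖u‖ ^ 2 / h ^ 2)) * (c + w u)
        ∂(ν + volume.restrict (Metric.ball (0 : E k) r)) - c * (Real.pi ^ ((k : ℝ) / 2) * h ^ k)| ≤
      (12 * D * F + 2 / r ^ 2 * F) * (2 * Real.pi) ^ ((k : ℝ) / 2) * h ^ (k + 2) := by
  have hF : 0 ≤ F := (abs_nonneg _).trans hc
  have := isFiniteMeasure_of_le_withDensity hν
  have hΓ := integrable_gauss (k := k) two_pos hh
  have hg : Integrable fun u : E k => Real.exp (-(‖u‖ ^ 2 / h ^ 2)) := by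
    simpa using integrable_gauss (k := k) one_pos hh
  have hgi : ∫ u : E k, Real.exp (-(‖u‖ ^ 2 / h ^ 2)) = Real.pi ^ ((k : ℝ) / 2) * h ^ k := by
    simpa using integral_gauss (k := k) one_pos hh
  have hΓ1 : ∀ u : E k, Real.exp (-(‖u‖ ^ 2 / h ^ 2 / 2)) ≤ 1 := fun u =>
    Real.exp_le_one_iff.2 (by simp only [Left.neg_nonpos_iff]; positivity)
  have hh2 : h ^ 2 ≤ 1 := pow_le_one₀ hh.le hh1
  have hwu : ∀ u, |w u| ≤ F * ‖u‖ := fun u => (w.le_opNorm u).trans (by gcongr)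
  have hcw : ∀ u, |c + w u| ≤ F * (1 + ‖u‖) := fun u =>
    (abs_add_le _ _).trans (by linarith [hwu u])
  have hq : ∀ u : E k, |Real.exp (-(‖u‖ ^ 2 / h ^ 2)) * (c + w u)| ≤
      4 * F * Real.exp (-(‖u‖ ^ 2 / h ^ 2 / 2)) := fun u => by
    have h1 := sq_mul_gauss_le (a := ‖u‖) hh
    have h2 := gauss_le_gauss_half (‖u‖ ^ 2 / h ^ 2) (by positivity)
    rw [abs_mul, abs_of_pos (Real.exp_pos _)]
    have h3 : 1 + ‖u‖ ≤ 2 + ‖u‖ ^ 2 := by nlinarith [sq_nonneg (‖u‖ - 1 / 2)]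
    have h4 : ‖u‖ ^ 2 * Real.exp (-(‖u‖ ^ 2 / h ^ 2)) ≤
        2 * 1 * Real.exp (-(‖u‖ ^ 2 / h ^ 2 / 2)) := h1.trans (by gcongr)
    calc Real.exp (-(‖u‖ ^ 2 / h ^ 2)) * |c + w u|
        ≤ Real.exp (-(‖u‖ ^ 2 / h ^ 2)) * (F * (2 + ‖u‖ ^ 2)) := by
          gcongr; exact (hcw u).trans (by gcongr)
      _ = F * (2 * Real.exp (-(‖u‖ ^ 2 / h ^ 2)) +
            ‖u‖ ^ 2 * Real.exp (-(‖u‖ ^ 2 / h ^ 2))) := by ring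
      _ ≤ F * (2 * Real.exp (-(‖u‖ ^ 2 / h ^ 2 / 2)) +
            2 * 1 * Real.exp (-(‖u‖ ^ 2 / h ^ 2 / 2))) := by
          gcongr
      _ = _ := by ring
  have hq2 : ∀ u : E k, D * ‖u‖ ^ 2 * |Real.exp (-(‖u‖ ^ 2 / h ^ 2)) * (c + w u)| ≤
      12 * D * F * h ^ 2 * Real.exp (-(‖u‖ ^ 2 / h ^ 2 / 2)) := fun u => by
    have h1 := sq_mul_gauss_le (a := ‖u‖) hh
    have h2 := pow_four_mul_gauss_le (a := ‖u‖) hh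
    rw [abs_mul, abs_of_pos (Real.exp_pos _)]
    have h3 : 1 + ‖u‖ ≤ 2 + ‖u‖ ^ 2 := by nlinarith [sq_nonneg (‖u‖ - 1 / 2)]
    have h4 : h ^ 4 ≤ h ^ 2 := by nlinarith [sq_nonneg h]
    have h5 : ‖u‖ ^ 4 * Real.exp (-(‖u‖ ^ 2 / h ^ 2)) ≤
        8 * h ^ 2 * Real.exp (-(‖u‖ ^ 2 / h ^ 2 / 2)) := h2.trans (by gcongr)
    calc D * ‖u‖ ^ 2 * (Real.exp (-(‖u‖ ^ 2 / h ^ 2)) * |c + w u|)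
        ≤ D * ‖u‖ ^ 2 * (Real.exp (-(‖u‖ ^ 2 / h ^ 2)) * (F * (2 + ‖u‖ ^ 2))) := by
          gcongr; exact (hcw u).trans (by gcongr)
      _ = D * F * (2 * (‖u‖ ^ 2 * Real.exp (-(‖u‖ ^ 2 / h ^ 2))) +
            ‖u‖ ^ 4 * Real.exp (-(‖u‖ ^ 2 / h ^ 2))) := by ring
      _ ≤ D * F * (2 * (2 * h ^ 2 * Real.exp (-(‖u‖ ^ 2 / h ^ 2 / 2))) +
            8 * h ^ 2 * Real.exp (-(‖u‖ ^ 2 / h ^ 2 / 2))) := by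
          gcongr
      _ = _ := by ring
  have hcont : Continuous fun u : E k => Real.exp (-(‖u‖ ^ 2 / h ^ 2)) * (c + w u) := by fun_prop
  have hqν : Integrable (fun u => Real.exp (-(‖u‖ ^ 2 / h ^ 2)) * (c + w u)) ν :=
    Integrable.of_bound hcont.aestronglyMeasurable (4 * F * 1) (ae_of_all _ fun u => by
      exact (hq u).trans (by gcongr; exact hΓ1 u))
  have hqv : Integrable (fun u => Real.exp (-(‖u‖ ^ 2 / h ^ 2)) * (c + w u)) volume :=
    (hΓ.const_mul (4 * F)).mono' hcont.aestronglyMeasurable (ae_of_all _ hq)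
  refine ⟨hqν.add_measure hqv.integrableOn, ?_⟩
  rw [integral_add_measure hqν hqv.integrableOn]
  have h1 : |∫ u, Real.exp (-(‖u‖ ^ 2 / h ^ 2)) * (c + w u) ∂ν| ≤
      12 * D * F * h ^ 2 * ((2 * Real.pi) ^ ((k : ℝ) / 2) * h ^ k) := by
    rw [← integral_gauss two_pos hh, ← integral_const_mul]
    refine (abs_integral_le_integral_abs).trans ((integral_le_of_le hD hν hcont.abs
      (fun u => abs_nonneg _) (B := 4 * F * 1)
      (fun u => (hq u).trans (by gcongr; exact hΓ1 u))).trans ?_)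
    refine (integral_mono_of_nonneg (ae_of_all _ fun u => by positivity)
      (hΓ.const_mul _).integrableOn (ae_of_all _ hq2)).trans ?_
    exact setIntegral_le_integral (hΓ.const_mul _) (ae_of_all _ fun u => by positivity)
  have h2 : ∫ u in Metric.ball (0 : E k) r, Real.exp (-(‖u‖ ^ 2 / h ^ 2)) * (c + w u) =
      c * ∫ u in Metric.ball (0 : E k) r, Real.exp (-(‖u‖ ^ 2 / h ^ 2)) := by
    have h3 : Integrable (fun u => Real.exp (-(‖u‖ ^ 2 / h ^ 2)) * w u) volume := by
      refine (hqv.sub (hg.mul_const c)).congr (ae_of_all _ fun u => ?_)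
      simp only [Pi.sub_apply]; ring
    simp only [mul_add]
    rw [integral_add (hg.mul_const c).integrableOn h3.integrableOn, setIntegral_ball_odd, add_zero,
      integral_mul_const, mul_comm]
  have h3 : |(∫ u in Metric.ball (0 : E k) r, Real.exp (-(‖u‖ ^ 2 / h ^ 2))) -
      Real.pi ^ ((k : ℝ) / 2) * h ^ k| ≤
      2 / r ^ 2 * h ^ 2 * ((2 * Real.pi) ^ ((k : ℝ) / 2) * h ^ k) := by
    rw [← hgi, ← integral_add_compl (measurableSet_ball (x := (0 : E k)) (ε := r)) hg,
      sub_add_cancel_left, abs_neg, abs_of_nonneg (integral_nonneg fun u => by positivity),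
      ← integral_gauss two_pos hh, ← integral_const_mul]
    refine (integral_mono_of_nonneg (ae_of_all _ fun u => by positivity)
      (hΓ.const_mul _).integrableOn ?_).trans
      (setIntegral_le_integral (hΓ.const_mul _) (ae_of_all _ fun u => by positivity))
    filter_upwards [ae_restrict_mem measurableSet_ball.compl] with u hu
    have hu' : r ≤ ‖u‖ := by simpa using hu
    calc Real.exp (-(‖u‖ ^ 2 / h ^ 2)) = 1 / r ^ 2 * (r ^ 2 * Real.exp (-(‖u‖ ^ 2 / h ^ 2))) := by
          field_simp
      _ ≤ 1 / r ^ 2 * (‖u‖ ^ 2 * Real.exp (-(‖u‖ ^ 2 / h ^ 2))) := by gcongr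
      _ ≤ 1 / r ^ 2 * (2 * h ^ 2 * Real.exp (-(‖u‖ ^ 2 / h ^ 2 / 2))) := by
          exact mul_le_mul_of_nonneg_left (sq_mul_gauss_le hh) (by positivity)
      _ = _ := by ring
  rw [h2, add_sub_assoc, ← mul_sub]
  calc _ ≤ _ := abs_add_le _ _
    _ ≤ 12 * D * F * h ^ 2 * ((2 * Real.pi) ^ ((k : ℝ) / 2) * h ^ k) +
        F * (2 / r ^ 2 * h ^ 2 * ((2 * Real.pi) ^ ((k : ℝ) / 2) * h ^ k)) := by
      rw [abs_mul]
      gcongr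
    _ = _ := by ring

end Tangent

/-! ### The bias -/

theorem exp_neg_sq_div_sq_le {r h : ℝ} (hr : 0 < r) (hh : 0 < h) (hh1 : h ≤ 1) (k : ℕ) :
    Real.exp (-(r ^ 2 / h ^ 2)) ≤ (k + 2).factorial / r ^ (2 * (k + 2)) * h ^ (k + 2) := by
  have h1 := Real.pow_div_factorial_le_exp (r ^ 2 / h ^ 2) (by positivity) (k + 2)
  rw [Real.exp_neg]
  have h2 : 0 < (r ^ 2 / h ^ 2) ^ (k + 2) / ((k + 2).factorial : ℝ) := by positivity
  calc (Real.exp (r ^ 2 / h ^ 2))⁻¹ ≤ ((r ^ 2 / h ^ 2) ^ (k + 2) / ((k + 2).factorial : ℝ))⁻¹ := by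
        gcongr
    _ = (k + 2).factorial / r ^ (2 * (k + 2)) * (h ^ (k + 2) * h ^ (k + 2)) := by
        rw [div_pow, ← pow_mul, ← pow_mul]
        field_simp
        rw [← pow_mul]; congr 1; ring
    _ ≤ (k + 2).factorial / r ^ (2 * (k + 2)) * (h ^ (k + 2) * 1) := by
        gcongr; exact pow_le_one₀ hh.le hh1
    _ = _ := by rw [mul_one]

/-- The constant in the second order bound for the bias of the Gaussian kernel estimator. -/
noncomputable def biasConst (k : ℕ) (C F r : ℝ) : ℝ :=
  (k + 2).factorial / r ^ (2 * (k + 2)) +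
    (128 * C ^ 2 * F + 8 * F) * ((1 + 2 ^ k * 16 * C ^ 2 * r ^ 2) * (2 * Real.pi) ^ ((k : ℝ) / 2)) +
    (12 * (2 ^ k * 16 * C ^ 2) * F + 2 / r ^ 2 * F) * (2 * Real.pi) ^ ((k : ℝ) / 2)

theorem abs_exp_neg_add_sub_le {a b : ℝ} (hb : 0 ≤ b) :
    |Real.exp (-(a + b)) - Real.exp (-a)| ≤ b * Real.exp (-a) := by
  have h1 : Real.exp (-(a + b)) = Real.exp (-a) * Real.exp (-b) := by
    rw [← Real.exp_add]; ring_nf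
  have h2 : Real.exp (-b) ≤ 1 := Real.exp_le_one_iff.2 (by linarith)
  have h3 : 1 - b ≤ Real.exp (-b) := by linarith [Real.add_one_le_exp (-b)]
  rw [h1, ← mul_sub_one, abs_mul, abs_of_pos (Real.exp_pos _), abs_of_nonpos (by linarith),
    mul_comm]
  gcongr
  linarith

namespace IsGraphOver
variable {d k : ℕ} {M : Set (E d)} {x : E d} {L : E k →ₗᵢ[ℝ] E d} {C s r F h : ℝ} {f : E d → ℝ}

/-- In the tangent plane, the integrand of the mean of the estimator is a Gaussian times an affine
function, up to a second order term. -/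
theorem abs_kernel_sub_le (hg : IsGraphOver M x L C s r) (hC : 0 ≤ C) (hx : x ∈ M)
    (hCs : C * s ≤ 1 / 2) (hh : 0 < h)
    (hfF : ∀ y ∈ M, ‖y - x‖ ≤ s → |f y| ≤ F) {w : E k →L[ℝ] ℝ}
    (hfw : ∀ y ∈ M, ‖y - x‖ ≤ s → |f y - f x - w (proj L (y - x))| ≤ F * ‖y - x‖ ^ 2)
    {y : E d} (hy : y ∈ M) (hys : ‖y - x‖ ≤ s) :
    |Real.exp (-(‖x - y‖ ^ 2 / h ^ 2)) * f y -
      Real.exp (-(‖proj L (y - x)‖ ^ 2 / h ^ 2)) * (f x + w (proj L (y - x)))| ≤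
      (128 * C ^ 2 * F + 8 * F) * h ^ 2 * Real.exp (-(‖proj L (y - x)‖ ^ 2 / h ^ 2 / 2)) := by
  have hF : 0 ≤ F := (abs_nonneg _).trans (hfF y hy hys)
  have h1 := hg.norm_normal_le hC hx hCs hy hys
  have h2 := norm_sq_eq_proj L (y - x)
  have h3 := hg.norm_sub_le hx hCs hy hys
  have h4 := hfw y hy hys
  have h5 := hfF y hy hys
  rw [norm_sub_rev x y, h2, add_div]
  set u := proj L (y - x)
  set η := ‖y - x - L u‖
  have h6 := abs_exp_neg_add_sub_le (a := ‖u‖ ^ 2 / h ^ 2) (b := η ^ 2 / h ^ 2) (by positivity)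
  have h7 : η ^ 2 / h ^ 2 * Real.exp (-(‖u‖ ^ 2 / h ^ 2)) ≤
      128 * C ^ 2 * h ^ 2 * Real.exp (-(‖u‖ ^ 2 / h ^ 2 / 2)) := by
    calc η ^ 2 / h ^ 2 * Real.exp (-(‖u‖ ^ 2 / h ^ 2))
        ≤ (4 * C * ‖u‖ ^ 2) ^ 2 / h ^ 2 * Real.exp (-(‖u‖ ^ 2 / h ^ 2)) := by gcongr
      _ = 16 * C ^ 2 / h ^ 2 * (‖u‖ ^ 4 * Real.exp (-(‖u‖ ^ 2 / h ^ 2))) := by ring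
      _ ≤ 16 * C ^ 2 / h ^ 2 * (8 * h ^ 4 * Real.exp (-(‖u‖ ^ 2 / h ^ 2 / 2))) :=
          mul_le_mul_of_nonneg_left (pow_four_mul_gauss_le hh) (by positivity)
      _ = _ := by field_simp; ring
  have h8 : F * ‖y - x‖ ^ 2 * Real.exp (-(‖u‖ ^ 2 / h ^ 2)) ≤
      8 * F * h ^ 2 * Real.exp (-(‖u‖ ^ 2 / h ^ 2 / 2)) := by
    calc F * ‖y - x‖ ^ 2 * Real.exp (-(‖u‖ ^ 2 / h ^ 2))
        ≤ F * (2 * ‖u‖) ^ 2 * Real.exp (-(‖u‖ ^ 2 / h ^ 2)) := by gcongr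
      _ = 4 * F * (‖u‖ ^ 2 * Real.exp (-(‖u‖ ^ 2 / h ^ 2))) := by ring
      _ ≤ 4 * F * (2 * h ^ 2 * Real.exp (-(‖u‖ ^ 2 / h ^ 2 / 2))) :=
          mul_le_mul_of_nonneg_left (sq_mul_gauss_le hh) (by positivity)
      _ = _ := by ring
  calc _ = |(Real.exp (-(‖u‖ ^ 2 / h ^ 2 + η ^ 2 / h ^ 2)) - Real.exp (-(‖u‖ ^ 2 / h ^ 2))) * f y +
        Real.exp (-(‖u‖ ^ 2 / h ^ 2)) * (f y - f x - w u)| := by congr 1; ring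
    _ ≤ |Real.exp (-(‖u‖ ^ 2 / h ^ 2 + η ^ 2 / h ^ 2)) - Real.exp (-(‖u‖ ^ 2 / h ^ 2))| * |f y| +
        Real.exp (-(‖u‖ ^ 2 / h ^ 2)) * |f y - f x - w u| := by
      refine (abs_add_le _ _).trans_eq ?_
      rw [abs_mul, abs_mul, abs_of_pos (Real.exp_pos (-(‖u‖ ^ 2 / h ^ 2)))]
    _ ≤ (128 * C ^ 2 * h ^ 2 * Real.exp (-(‖u‖ ^ 2 / h ^ 2 / 2))) * F +
        Real.exp (-(‖u‖ ^ 2 / h ^ 2)) * (F * ‖y - x‖ ^ 2) := by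
      gcongr
      exact h6.trans h7
    _ ≤ (128 * C ^ 2 * h ^ 2 * Real.exp (-(‖u‖ ^ 2 / h ^ 2 / 2))) * F +
        8 * F * h ^ 2 * Real.exp (-(‖u‖ ^ 2 / h ^ 2 / 2)) := by
      rw [mul_comm (Real.exp _) (F * _)]
      gcongr
    _ = _ := by ring

/-- The bias of the Gaussian kernel estimator is of second order in the bandwidth. -/
theorem abs_integral_sub_le (hg : IsGraphOver M x L C s r) (hC : 0 ≤ C) (hx : x ∈ M)
    (hM : MeasurableSet M) (hs : 0 ≤ s) (hr : 0 < r) (hCs : C * s ≤ 1 / 2) (hrs : 2 * r ≤ s)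
    (hh : 0 < h) (hh1 : h ≤ 1)
    (hf0 : ∀ y ∈ M, 0 ≤ f y) (hfi : IntegrableOn f M (Measure.euclideanHausdorffMeasure k))
    (hf1 : ∫ y in M, f y ∂(Measure.euclideanHausdorffMeasure k) ≤ 1)
    (hfF : ∀ y ∈ M, ‖y - x‖ ≤ s → |f y| ≤ F) {w : E k →L[ℝ] ℝ} (hw : ‖w‖ ≤ F)
    (hfw : ∀ y ∈ M, ‖y - x‖ ≤ s → |f y - f x - w (proj L (y - x))| ≤ F * ‖y - x‖ ^ 2) :
    |∫ y in M, Real.exp (-(‖x - y‖ ^ 2 / h ^ 2)) * f y ∂(Measure.euclideanHausdorffMeasure k) -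
      f x * (Real.pi ^ ((k : ℝ) / 2) * h ^ k)| ≤ biasConst k C F r * h ^ (k + 2) := by
  have hx0 : |f x| ≤ F := hfF x hx (by simpa using hs)
  have hF : 0 ≤ F := (abs_nonneg _).trans hx0
  set H : Measure (E d) := Measure.euclideanHausdorffMeasure k
  set N := graphPiece M x L s r with hN
  have hNm : MeasurableSet N := measurableSet_graphPiece hM x L s r
  have hNM : N ⊆ M := inter_subset_left
  obtain ⟨ν, hμ, hν⟩ := hg.exists_map_eq_add hC hx hr hCs hrs
  have hD : (0 : ℝ) ≤ 2 ^ k * 16 * C ^ 2 := by positivity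
  have hq := abs_integral_gauss_affine_sub_le hD hr hh hh1 hν hx0 hw
  have hΓ := integral_gauss_half_le hD hh hν
  rw [← hμ] at hq hΓ
  have hπ : Measurable fun y => proj L (y - x) := (continuous_proj_sub x L).measurable
  have hfin : IsFiniteMeasure ((H.restrict N).map fun y => proj L (y - x)) := by
    have := isFiniteMeasure_of_le_withDensity hν
    have : IsFiniteMeasure (volume.restrict (Metric.ball (0 : E k) r)) :=
      ⟨by simpa using measure_ball_lt_top⟩
    rw [hμ]; infer_instance
  have hΓc : Continuous fun u : E k => Real.exp (-(‖u‖ ^ 2 / h ^ 2 / 2)) := by fun_prop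
  have hΓi : Integrable (fun u : E k => Real.exp (-(‖u‖ ^ 2 / h ^ 2 / 2)))
      ((H.restrict N).map fun y => proj L (y - x)) :=
    Integrable.of_bound hΓc.aestronglyMeasurable 1 (ae_of_all _ fun u => by
      rw [Real.norm_of_nonneg (by positivity)]
      exact Real.exp_le_one_iff.2 (by simp only [Left.neg_nonpos_iff]; positivity))
  have hΓN := hΓi.comp_measurable hπ
  have hqN := hq.1.comp_measurable hπ
  rw [integral_map hπ.aemeasurable hΓc.aestronglyMeasurable] at hΓ
  rw [integral_map hπ.aemeasurable hq.1.aestronglyMeasurable] at hq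
  have hkc : Continuous fun y : E d => Real.exp (-(‖x - y‖ ^ 2 / h ^ 2)) := by fun_prop
  have hk1 : ∀ y : E d, Real.exp (-(‖x - y‖ ^ 2 / h ^ 2)) ≤ 1 := fun y =>
    Real.exp_le_one_iff.2 (by simp only [Left.neg_nonpos_iff]; positivity)
  have hki : IntegrableOn (fun y => Real.exp (-(‖x - y‖ ^ 2 / h ^ 2)) * f y) M H :=
    Integrable.bdd_mul hfi hkc.aestronglyMeasurable (c := 1) (ae_of_all _ fun y => by
      rw [Real.norm_of_nonneg (by positivity)]; exact hk1 y)
  -- outside the graph piece, points of `M` are at distance at least `r` from `x`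
  have hsplit := integral_inter_add_sdiff hNm hki
  rw [inter_eq_self_of_subset_right hNM] at hsplit
  have hfar : |∫ y in M \ N, Real.exp (-(‖x - y‖ ^ 2 / h ^ 2)) * f y ∂H| ≤
      (k + 2).factorial / r ^ (2 * (k + 2)) * h ^ (k + 2) := by
    refine le_trans ?_ (exp_neg_sq_div_sq_le hr hh hh1 k)
    have hnn : 0 ≤ᵐ[H.restrict M] f := by
      filter_upwards [ae_restrict_mem hM] with y hy using hf0 y hy
    rw [abs_of_nonneg (setIntegral_nonneg (hM.diff hNm) fun y hy =>
      mul_nonneg (Real.exp_pos _).le (hf0 y hy.1))]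
    calc ∫ y in M \ N, Real.exp (-(‖x - y‖ ^ 2 / h ^ 2)) * f y ∂H
        ≤ ∫ y in M \ N, Real.exp (-(r ^ 2 / h ^ 2)) * f y ∂H := by
          refine setIntegral_mono_on (hki.mono_set sdiff_subset)
            ((hfi.mono_set sdiff_subset).const_mul _) (hM.diff hNm) fun y hy => ?_
          have hry : r ≤ ‖x - y‖ := by
            by_contra hlt
            rw [not_le, norm_sub_rev] at hlt
            exact hy.2 ⟨hy.1, mem_closedBall_iff_norm.2 (by linarith),
              (norm_proj_le L _).trans_lt hlt⟩
          have := hf0 y hy.1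
          gcongr
      _ = Real.exp (-(r ^ 2 / h ^ 2)) * ∫ y in M \ N, f y ∂H := integral_const_mul _ _
      _ ≤ Real.exp (-(r ^ 2 / h ^ 2)) * 1 := by
          gcongr
          exact (setIntegral_mono_set hfi hnn sdiff_subset.eventuallyLE).trans hf1
      _ = _ := mul_one _
  have hnear : |∫ y in N, Real.exp (-(‖x - y‖ ^ 2 / h ^ 2)) * f y ∂H -
      ∫ y in N, Real.exp (-(‖proj L (y - x)‖ ^ 2 / h ^ 2)) * (f x + w (proj L (y - x))) ∂H| ≤
      (128 * C ^ 2 * F + 8 * F) * h ^ 2 *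
        ((1 + 2 ^ k * 16 * C ^ 2 * r ^ 2) * (2 * Real.pi) ^ ((k : ℝ) / 2) * h ^ k) := by
    have hsub := integral_sub (hki.mono_set hNM) hqN
    simp only [Function.comp_apply] at hsub
    rw [← hsub]
    refine abs_integral_le_integral_abs.trans ?_
    calc _ ≤ ∫ y in N, (128 * C ^ 2 * F + 8 * F) * h ^ 2 *
          Real.exp (-(‖proj L (y - x)‖ ^ 2 / h ^ 2 / 2)) ∂H := by
          refine setIntegral_mono_on ((hki.mono_set hNM).sub hqN).abs (hΓN.const_mul _) hNm
            fun y hy => ?_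
          exact hg.abs_kernel_sub_le hC hx hCs hh hfF hfw hy.1 (mem_closedBall_iff_norm.1 hy.2.1)
      _ = _ := integral_const_mul _ _
      _ ≤ _ := by gcongr
  rw [← hsplit]
  calc _ = |(∫ y in M \ N, Real.exp (-(‖x - y‖ ^ 2 / h ^ 2)) * f y ∂H) +
        (∫ y in N, Real.exp (-(‖x - y‖ ^ 2 / h ^ 2)) * f y ∂H -
          ∫ y in N, Real.exp (-(‖proj L (y - x)‖ ^ 2 / h ^ 2)) * (f x + w (proj L (y - x))) ∂H) +
        ((∫ y in N, Real.exp (-(‖proj L (y - x)‖ ^ 2 / h ^ 2)) * (f x + w (proj L (y - x))) ∂H) -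
          f x * (Real.pi ^ ((k : ℝ) / 2) * h ^ k))| := by congr 1; ring
    _ ≤ _ := abs_add_three _ _ _
    _ ≤ _ := add_le_add (add_le_add hfar hnear) hq.2
    _ = _ := by rw [biasConst]; ring

end IsGraphOver

theorem IsC2FunctionOn.continuousOn {d : ℕ} {f : E d → ℝ} {M : Set (E d)}
    (hf : IsC2FunctionOn f M) : ContinuousOn f M := fun p hp => by
  obtain ⟨U, hU, hpU, g, hg, hfg⟩ := hf p hp
  have h1 : ContinuousWithinAt f (M ∩ U) p :=
    ((hg.contDiffAt (hU.mem_nhds hpU)).continuousAt.continuousWithinAt).congr hfg (hfg ⟨hp, hpU⟩)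
  exact (continuousWithinAt_inter (hU.mem_nhds hpU)).1 h1

/-- Near an interior point, the mean of the (unnormalised) Gaussian kernel is, uniformly, the
density up to a second order term. -/
theorem IsInteriorPt.exists_bias_le {d k : ℕ} (hkd : k ≤ d) {M : Set (E d)} (hM : MeasurableSet M)
    {f : E d → ℝ} (hf0 : ∀ x ∈ M, 0 ≤ f x) (hf : IsC2FunctionOn f M)
    (hfi : IntegrableOn f M (Measure.euclideanHausdorffMeasure k))
    (hf1 : ∫ y in M, f y ∂(Measure.euclideanHausdorffMeasure k) ≤ 1)
    {p : E d} (hp : IsInteriorPt k M p) :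
    ∃ A : ℝ, ∀ᶠ x in 𝓝[M] p, ∀ h : ℝ, 0 < h → h ≤ 1 →
      |∫ y in M, Real.exp (-(‖x - y‖ ^ 2 / h ^ 2)) * f y ∂(Measure.euclideanHausdorffMeasure k) -
        f x * (Real.pi ^ ((k : ℝ) / 2) * h ^ k)| ≤ A * h ^ (k + 2) := by
  have hpM : p ∈ M := by obtain ⟨Φ, -, -, h, -⟩ := hp; exact h
  obtain ⟨U, hU, hpU, g, hg, hfg⟩ := hf p hpM
  have hgp := hg.contDiffAt (hU.mem_nhds hpU)
  obtain ⟨K, t, hK, ht, hgK, hgd, hge⟩ := exists_fderiv_expansion hgp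
  have hgb : ∀ᶠ y in 𝓝 p, |g y| < |g p| + 1 :=
    hgp.continuousAt.abs.eventually_lt_const (by simp)
  obtain ⟨q, hq, hball⟩ := Metric.mem_nhds_iff.1
    (inter_mem ((hU.mem_nhds hpU)) (inter_mem hgb (Metric.ball_mem_nhds p ht)))
  obtain ⟨C, s, r, hC, hs, hsq, hr, hrs, hCs, hgraph⟩ :=
    hp.exists_isGraphOver hkd (q / 2) (by linarith)
  have hin : ∀ x y, ‖x - p‖ < s → ‖y - x‖ ≤ s → y ∈ Metric.ball p q := fun x y hx hy => by
    rw [mem_ball_iff_norm]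
    calc ‖y - p‖ = ‖(y - x) + (x - p)‖ := by congr 1; abel
      _ ≤ ‖y - x‖ + ‖x - p‖ := norm_add_le _ _
      _ < q := by linarith
  set F := |g p| + 1 + K + 4 * C * K with hF
  have hg0 := abs_nonneg (g p)
  have hCK : 0 ≤ 4 * C * K := by positivity
  refine ⟨biasConst k C F r, ?_⟩
  filter_upwards [self_mem_nhdsWithin, mem_nhdsWithin_of_mem_nhds (Metric.ball_mem_nhds p hs)]
    with x hxM hxs h hh hh1
  rw [mem_ball_iff_norm] at hxs
  obtain ⟨L, hL⟩ := hgraph x hxM hxs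
  have hxq := hball (hin x x hxs (by simpa using hs.le))
  refine hL.abs_integral_sub_le hC.le hxM hM hs.le hr hCs hrs hh hh1 hf0 hfi hf1
    (F := F) (w := (fderiv ℝ g x).comp L.toContinuousLinearMap) ?_ ?_ ?_
  · intro y hy hyx
    have hyq := hball (hin x y hxs hyx)
    rw [hfg ⟨hy, hyq.1⟩]
    have : |g y| < |g p| + 1 := hyq.2.1
    linarith
  · refine (ContinuousLinearMap.opNorm_comp_le _ _).trans ?_
    calc _ ≤ K * 1 := by
          gcongr
          · exact hgK x hxq.2.2
          · exact L.norm_toContinuousLinearMap_le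
      _ ≤ F := by linarith
  · intro y hy hyx
    have hyq := hball (hin x y hxs hyx)
    rw [hfg ⟨hy, hyq.1⟩, hfg ⟨hxM, hxq.1⟩]
    have h1 := hge x hxq.2.2 y hyq.2.2 x hxq.2.2 ‖y - x‖ le_rfl (by simp)
    rw [Real.norm_eq_abs] at h1
    have h2 := hL.norm_normal_le hC.le hxM hCs hy hyx
    have h3 : ‖fderiv ℝ g x (y - x - L (proj L (y - x)))‖ ≤ K * (4 * C * ‖y - x‖ ^ 2) := by
      refine ((fderiv ℝ g x).le_opNorm _).trans ?_
      gcongr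
      · exact hgK x hxq.2.2
      · refine h2.trans ?_
        gcongr
        exact norm_proj_le L _
    rw [Real.norm_eq_abs] at h3
    have h4 : g y - g x - ((fderiv ℝ g x).comp L.toContinuousLinearMap) (proj L (y - x)) =
        (g y - g x - fderiv ℝ g x (y - x)) + fderiv ℝ g x (y - x - L (proj L (y - x))) := by
      rw [map_sub (fderiv ℝ g x) (y - x)]
      simp
    rw [h4]
    calc _ ≤ _ := abs_add_le _ _
      _ ≤ K * ‖y - x‖ * ‖y - x‖ + K * (4 * C * ‖y - x‖ ^ 2) := add_le_add h1 h3
      _ = (K + 4 * C * K) * ‖y - x‖ ^ 2 := by ring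
      _ ≤ _ := by gcongr; linarith

theorem exists_bias_le_of_isCompact {d k : ℕ} (hkd : k ≤ d) {M M₀ : Set (E d)}
    (hM : MeasurableSet M) {f : E d → ℝ} (hf0 : ∀ x ∈ M, 0 ≤ f x) (hf : IsC2FunctionOn f M)
    (hfi : IntegrableOn f M (Measure.euclideanHausdorffMeasure k))
    (hf1 : ∫ y in M, f y ∂(Measure.euclideanHausdorffMeasure k) ≤ 1)
    (hM₀ : IsCompact M₀) (hM₀M : M₀ ⊆ M) (hint : ∀ p ∈ M₀, IsInteriorPt k M p) :
    ∃ A : ℝ, ∀ x ∈ M₀, ∀ h : ℝ, 0 < h → h ≤ 1 →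
      |∫ y in M, Real.exp (-(‖x - y‖ ^ 2 / h ^ 2)) * f y ∂(Measure.euclideanHausdorffMeasure k) -
        f x * (Real.pi ^ ((k : ℝ) / 2) * h ^ k)| ≤ A * h ^ (k + 2) := by
  refine hM₀.induction_on (p := fun S => ∃ A : ℝ, ∀ x ∈ S, ∀ h : ℝ, 0 < h → h ≤ 1 →
      |∫ y in M, Real.exp (-(‖x - y‖ ^ 2 / h ^ 2)) * f y ∂(Measure.euclideanHausdorffMeasure k) -
        f x * (Real.pi ^ ((k : ℝ) / 2) * h ^ k)| ≤ A * h ^ (k + 2)) ⟨0, by simp⟩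
    (fun S T hST ⟨A, hA⟩ => ⟨A, fun x hx => hA x (hST hx)⟩) ?_ fun p hp => ?_
  · rintro S T ⟨A, hA⟩ ⟨B, hB⟩
    refine ⟨max A B, fun x hx h hh hh1 => ?_⟩
    rcases hx with hx | hx
    · exact (hA x hx h hh hh1).trans (by gcongr; exact le_max_left _ _)
    · exact (hB x hx h hh hh1).trans (by gcongr; exact le_max_right _ _)
  · obtain ⟨A, hA⟩ := (hint p hp).exists_bias_le hkd hM hf0 hf hfi hf1
    exact ⟨_, nhdsWithin_mono p hM₀M hA, A, fun x hx => hx⟩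

/-! ### Concentration inequalities and nets -/

section Concentration
variable {Ω : Type*} [MeasurableSpace Ω] {P : Measure Ω} [IsProbabilityMeasure P]

/-- The bound on the moment generating function of a centred variable with values in `[-1, 1]`, from
`exp z ≤ 1 + z + z²` for `|z| ≤ 1`. -/
theorem mgf_le_exp {Z : Ω → ℝ} (hZ : Measurable Z) (hb : ∀ ω, |Z ω| ≤ 1) (h0 : ∫ ω, Z ω ∂P = 0)
    {v : ℝ} (hv : ∫ ω, Z ω ^ 2 ∂P ≤ v) {t : ℝ} (ht0 : 0 ≤ t) (ht1 : t ≤ 1) :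
    mgf Z P t ≤ Real.exp (t ^ 2 * v) := by
  have hZi : Integrable Z P := Integrable.of_bound hZ.aestronglyMeasurable 1 (ae_of_all _ hb)
  have hZ2 : Integrable (fun ω => Z ω ^ 2) P :=
    Integrable.of_bound (hZ.pow_const 2).aestronglyMeasurable 1 (ae_of_all _ fun ω => by
      rw [Real.norm_eq_abs, abs_pow]; exact pow_le_one₀ (abs_nonneg _) (hb ω))
  have h1 : ∀ ω, Real.exp (t * Z ω) ≤ 1 + t * Z ω + t ^ 2 * Z ω ^ 2 := fun ω => by
    have h2 : |t * Z ω| ≤ 1 := by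
      rw [abs_mul, abs_of_nonneg ht0]; exact mul_le_one₀ ht1 (abs_nonneg _) (hb ω)
    have h3 := (abs_le.1 (Real.abs_exp_sub_one_sub_id_le h2)).2
    rw [mul_pow] at h3
    linarith
  have h2 : Integrable (fun ω => 1 + t * Z ω) P := (integrable_const 1).add (hZi.const_mul t)
  calc mgf Z P t ≤ ∫ ω, 1 + t * Z ω + t ^ 2 * Z ω ^ 2 ∂P :=
        integral_mono_of_nonneg (ae_of_all _ fun ω => (Real.exp_pos _).le)
          (h2.add (hZ2.const_mul _)) (ae_of_all _ h1)
    _ = 1 + t ^ 2 * ∫ ω, Z ω ^ 2 ∂P := by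
        rw [integral_add h2 (hZ2.const_mul _), integral_add (integrable_const 1) (hZi.const_mul t),
          integral_const_mul, integral_const_mul, h0]
        simp
    _ ≤ 1 + t ^ 2 * v := by gcongr
    _ ≤ _ := by linarith [Real.add_one_le_exp (t ^ 2 * v)]

theorem measureReal_sum_ge_le {Z : ℕ → Ω → ℝ} (hZ : ∀ i, Measurable (Z i)) (hind : iIndepFun Z P)
    (hb : ∀ i ω, |Z i ω| ≤ 1) (h0 : ∀ i, ∫ ω, Z i ω ∂P = 0) {v : ℝ}
    (hv : ∀ i, ∫ ω, Z i ω ^ 2 ∂P ≤ v) {t : ℝ} (ht0 : 0 ≤ t) (ht1 : t ≤ 1) (ε : ℝ) (n : ℕ) :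
    P.real {ω | ε ≤ ∑ i ∈ Finset.range n, Z i ω} ≤ Real.exp (-t * ε + n * (t ^ 2 * v)) := by
  have hsum : ∀ ω, |∑ i ∈ Finset.range n, Z i ω| ≤ n := fun ω =>
    (Finset.abs_sum_le_sum_abs _ _).trans
      ((Finset.sum_le_sum fun i _ => hb i ω).trans_eq (by simp))
  have hint : Integrable (fun ω => Real.exp (t * (∑ i ∈ Finset.range n, Z i) ω)) P := by
    refine Integrable.of_bound (by fun_prop) (Real.exp n) (ae_of_all _ fun ω => ?_)
    rw [Real.norm_of_nonneg (Real.exp_pos _).le, Finset.sum_apply]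
    refine Real.exp_le_exp.2 ((le_abs_self _).trans ?_)
    rw [abs_mul, abs_of_nonneg ht0]
    exact (mul_le_of_le_one_left (abs_nonneg _) ht1).trans (hsum ω)
  have h1 := measure_ge_le_exp_mul_mgf ε ht0 hint
  simp only [Finset.sum_apply] at h1
  refine h1.trans ?_
  rw [Real.exp_add, hind.mgf_sum hZ]
  gcongr
  calc _ ≤ ∏ i ∈ Finset.range n, Real.exp (t ^ 2 * v) :=
        Finset.prod_le_prod (fun i _ => mgf_nonneg)
          fun i _ => mgf_le_exp (hZ i) (hb i) (h0 i) (hv i) ht0 ht1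
    _ = _ := by rw [Finset.prod_const, Finset.card_range, ← Real.exp_nat_mul]

/-- A Bernstein type inequality. -/
theorem measureReal_abs_sum_ge_le {Z : ℕ → Ω → ℝ} (hZ : ∀ i, Measurable (Z i))
    (hind : iIndepFun Z P) (hb : ∀ i ω, |Z i ω| ≤ 1) (h0 : ∀ i, ∫ ω, Z i ω ∂P = 0) {v : ℝ}
    (hv : ∀ i, ∫ ω, Z i ω ^ 2 ∂P ≤ v) {t : ℝ} (ht0 : 0 ≤ t) (ht1 : t ≤ 1) (ε : ℝ) (n : ℕ) :
    P.real {ω | ε ≤ |∑ i ∈ Finset.range n, Z i ω|} ≤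
      2 * Real.exp (-t * ε + n * (t ^ 2 * v)) := by
  have h1 := measureReal_sum_ge_le hZ hind hb h0 hv ht0 ht1 ε n
  have h2 := measureReal_sum_ge_le (Z := fun i ω => -Z i ω) (fun i => (hZ i).neg)
    (hind.comp (fun _ z => -z) fun _ => measurable_neg) (by simpa using hb)
    (fun i => by rw [integral_neg, h0 i, neg_zero]) (by simpa using hv) ht0 ht1 ε n
  have h3 : {ω | ε ≤ |∑ i ∈ Finset.range n, Z i ω|} ⊆
      {ω | ε ≤ ∑ i ∈ Finset.range n, Z i ω} ∪ {ω | ε ≤ ∑ i ∈ Finset.range n, -Z i ω} := by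
    intro ω hω
    simpa [Finset.sum_neg_distrib] using le_abs.1 hω
  refine (measureReal_mono h3).trans ((measureReal_union_le _ _).trans ?_)
  linarith

/-- The Bernstein type inequality for functions with values in `[0, 1]` of independent variables. -/
theorem measureReal_abs_sum_sub_ge_le {α : Type*} [MeasurableSpace α] {X : ℕ → Ω → α}
    (hX : ∀ i, Measurable (X i)) (hind : iIndepFun X P) {G : α → ℝ} (hG : Measurable G)
    (hG0 : ∀ y, 0 ≤ G y) (hG1 : ∀ y, G y ≤ 1) {m v : ℝ} (hm : ∀ i, ∫ ω, G (X i ω) ∂P = m)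
    (hmv : m ≤ v) {t : ℝ} (ht0 : 0 ≤ t) (ht1 : t ≤ 1) (ε : ℝ) (n : ℕ) :
    P.real {ω | ε ≤ |∑ i ∈ Finset.range n, G (X i ω) - n * m|} ≤
      2 * Real.exp (-t * ε + n * (t ^ 2 * v)) := by
  have hGi : ∀ i, Integrable (fun ω => G (X i ω)) P := fun i =>
    Integrable.of_bound (hG.comp (hX i)).aestronglyMeasurable 1 (ae_of_all _ fun ω => by
      rw [Real.norm_of_nonneg (hG0 _)]; exact hG1 _)
  have hm0 : 0 ≤ m := by rw [← hm 0]; exact integral_nonneg fun ω => hG0 _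
  have hm1 : m ≤ 1 := by
    rw [← hm 0]
    refine (integral_mono (hGi 0) (integrable_const 1) fun ω => hG1 _).trans_eq ?_
    simp
  have h1 := measureReal_abs_sum_ge_le (P := P) (Z := fun i ω => G (X i ω) - m) (v := v)
    (fun i => (hG.comp (hX i)).sub_const m) (hind.comp (fun _ y => G y - m) fun _ => hG.sub_const m)
    (fun i ω => abs_le.2 ⟨by linarith [hG0 (X i ω)], by linarith [hG1 (X i ω)]⟩)
    (fun i => by rw [integral_sub (hGi i) (integrable_const m), hm i]; simp) (fun i => ?_)
    ht0 ht1 ε n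
  · simpa [Finset.sum_sub_distrib] using h1
  · calc ∫ ω, (G (X i ω) - m) ^ 2 ∂P ≤ ∫ ω, ((1 - 2 * m) * G (X i ω) + m ^ 2) ∂P := by
          refine integral_mono_of_nonneg (ae_of_all _ fun ω => sq_nonneg _)
            (((hGi i).const_mul _).add (integrable_const _)) (ae_of_all _ fun ω => ?_)
          nlinarith [mul_nonneg (hG0 (X i ω)) (sub_nonneg.2 (hG1 (X i ω)))]
      _ = (1 - 2 * m) * m + m ^ 2 := by
          rw [integral_add ((hGi i).const_mul _) (integrable_const _), integral_const_mul, hm i]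
          simp
      _ ≤ v := by nlinarith

end Concentration

/-- A bounded set of `ℝ^d` has a `1 / m`-net with `O(m^d)` points. -/
theorem exists_finset_net {d : ℕ} {S : Set (E d)} (hS : Bornology.IsBounded S) :
    ∃ c : ℕ, ∀ m : ℕ, 0 < m → ∃ T : Finset (E d), ↑T ⊆ S ∧ T.card ≤ (c * m) ^ d ∧
      ∀ x ∈ S, ∃ y ∈ T, ‖x - y‖ ≤ 1 / m := by
  classical
  obtain ⟨R₀, hR₀⟩ := hS.exists_norm_le
  obtain ⟨R, hR⟩ := exists_nat_ge R₀
  refine ⟨2 * R * (d + 1) + 2, fun m hm => ?_⟩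
  -- a grid of mesh `1 / (m * (d + 1))`: two points in the same cell are at distance at most
  -- `1 / m`, bounding the norm by the sum of the coordinates
  let g : E d → Fin d → ℤ := fun x i => ⌊x i * (m * (d + 1))⌋
  let box : Finset (Fin d → ℤ) :=
    Fintype.piFinset fun _ => Finset.Icc (-(R * m * (d + 1) : ℤ)) (R * m * (d + 1))
  have hg : ∀ x ∈ S, g x ∈ box := fun x hx => by
    refine Fintype.mem_piFinset.2 fun i => Finset.mem_Icc.2 ?_
    have h1 : |x i| ≤ R := (PiLp.norm_apply_le x i).trans ((hR₀ x hx).trans hR)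
    have h2 := abs_le.1 h1
    have h3 : (0 : ℝ) ≤ m * (d + 1) := by positivity
    constructor
    · refine Int.le_floor.2 ?_
      push_cast
      nlinarith [mul_le_mul_of_nonneg_right h2.1 h3]
    · refine Int.floor_le_iff.2 ?_
      push_cast
      nlinarith [mul_le_mul_of_nonneg_right h2.2 h3]
  have hsur : ∀ b ∈ g '' S, ∃ x ∈ S, g x = b := fun b hb => hb
  choose! φ hφS hφ using hsur
  have hfin : (g '' S).Finite := box.finite_toSet.subset (by rintro _ ⟨x, hx, rfl⟩; exact hg x hx)
  refine ⟨hfin.toFinset.image φ, ?_, ?_, fun x hx => ⟨φ (g x), ?_, ?_⟩⟩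
  · intro y hy
    obtain ⟨b, hb, rfl⟩ := Finset.mem_image.1 (Finset.mem_coe.1 hy)
    exact hφS b (hfin.mem_toFinset.1 hb)
  · refine Finset.card_image_le.trans ((Finset.card_le_card (t := box) ?_).trans ?_)
    · intro b hb
      obtain ⟨x, hx, rfl⟩ := hfin.mem_toFinset.1 hb
      exact hg x hx
    · rw [Fintype.card_piFinset_const, Int.card_Icc]
      refine Nat.pow_le_pow_left ?_ d
      have : ((R * m * (d + 1) : ℤ) + 1 - -(R * m * (d + 1) : ℤ)).toNat =
          2 * (R * m * (d + 1)) + 1 := by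
        have : ((R * m * (d + 1) : ℤ) + 1 - -(R * m * (d + 1) : ℤ)) =
          ((2 * (R * m * (d + 1)) + 1 : ℕ) : ℤ) := by push_cast; ring
        rw [this, Int.toNat_natCast]
      rw [this]
      nlinarith
  · exact Finset.mem_image_of_mem _ (hfin.mem_toFinset.2 (mem_image_of_mem g hx))
  · have h1 : ∀ i, ‖(x - φ (g x)) i‖ ≤ 1 / (m * (d + 1)) := fun i => by
      have h2 := Int.abs_sub_lt_one_of_floor_eq_floor
        (congrFun (hφ (g x) (mem_image_of_mem g hx)) i).symm
      have hmd : (0 : ℝ) < m * (d + 1) := by positivity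
      rw [← sub_mul, abs_mul, abs_of_pos hmd] at h2
      rw [le_div_iff₀ hmd]
      exact h2.le
    have hnorm : ‖x - φ (g x)‖ ≤ ∑ i, ‖(x - φ (g x)) i‖ := by
      rw [EuclideanSpace.norm_eq]
      refine Real.sqrt_le_left (Finset.sum_nonneg fun i _ => norm_nonneg _) |>.2 ?_
      exact Finset.sum_sq_le_sq_sum_of_nonneg fun i _ => norm_nonneg _
    have hm' : (0 : ℝ) < m := by exact_mod_cast hm
    calc _ ≤ _ := hnorm
      _ ≤ ∑ _i : Fin d, 1 / ((m : ℝ) * (d + 1)) := Finset.sum_le_sum fun i _ => h1 i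
      _ = d / (d + 1) * (1 / m) := by simp; field_simp
      _ ≤ 1 * (1 / m) := by
          gcongr
          rw [div_le_one (by positivity)]
          linarith
      _ = _ := one_mul _

theorem abs_exp_neg_sq_sub_le (a b : ℝ) :
    |Real.exp (-a ^ 2) - Real.exp (-b ^ 2)| ≤ |a - b| := by
  have hd : ∀ t : ℝ, HasDerivAt (fun t : ℝ => Real.exp (-t ^ 2)) (Real.exp (-t ^ 2) * -(2 * t)) t :=
    fun t => by simpa using ((hasDerivAt_id t).pow 2).neg.exp
  have h := convex_univ.norm_image_sub_le_of_norm_hasDerivWithin_le (C := 1) (x := b) (y := a)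
    (fun t _ => (hd t).hasDerivWithinAt) (fun t _ => ?_) (mem_univ _) (mem_univ _)
  · simpa [Real.norm_eq_abs] using h
  · rw [Real.norm_eq_abs, abs_mul, abs_of_pos (Real.exp_pos _), abs_neg, abs_mul, abs_two]
    have h1 : 2 * |t| ≤ Real.exp (t ^ 2) := by
      nlinarith [Real.add_one_le_exp (t ^ 2), sq_nonneg (|t| - 1), sq_abs t]
    calc Real.exp (-t ^ 2) * (2 * |t|) ≤ Real.exp (-t ^ 2) * Real.exp (t ^ 2) := by gcongr
      _ = 1 := by rw [← Real.exp_add]; simp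

theorem abs_gauss_sub_le {d : ℕ} {h : ℝ} (hh : 0 < h) (x x' y : E d) :
    |Real.exp (-(‖x - y‖ ^ 2 / h ^ 2)) - Real.exp (-(‖x' - y‖ ^ 2 / h ^ 2))| ≤ ‖x - x'‖ / h := by
  rw [← div_pow, ← div_pow]
  refine (abs_exp_neg_sq_sub_le _ _).trans ?_
  rw [← sub_div, abs_div, abs_of_pos hh]
  gcongr
  simpa using abs_norm_sub_norm_le (x - y) (x' - y)

/-! ### The uniform fluctuation bound -/

theorem finite_of_isInteriorPt_zero {d : ℕ} {M M₀ : Set (E d)} (hM₀ : IsCompact M₀)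
    (hM₀M : M₀ ⊆ M) (hint : ∀ p ∈ M₀, IsInteriorPt 0 M p) : M₀.Finite := by
  refine hM₀.induction_on (p := Set.Finite) finite_empty (fun S T hST hT => hT.subset hST)
    (fun S T hS hT => hS.union hT) fun p hp => ⟨{p}, ?_, finite_singleton p⟩
  obtain ⟨ψ, τ, -, -, hψτ, hG, -⟩ := (hint p hp).exists_parametrization (Nat.zero_le d)
  filter_upwards [self_mem_nhdsWithin, mem_nhdsWithin_of_mem_nhds hG] with y hy hyG
  rw [mem_singleton_iff, ← hyG (hM₀M hy), Subsingleton.elim (τ y) (τ p), hψτ]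

/-- Finite nets of polynomial size, fine enough for the variation of the estimator over a mesh to
be negligible. In dimension `0` there is no lower bound on the bandwidth, but then the set itself is
finite. -/
theorem exists_nets {d k : ℕ} {M₀ : Set (E d)} (hM₀ : Bornology.IsBounded M₀)
    (hfin : k = 0 → M₀.Finite) {h β : ℕ → ℝ} (h_pos : ∀ n, 0 < h n)
    (h_zero : Tendsto h atTop (𝓝 0)) (hβ : Tendsto β atTop atTop)
    (hrate : Tendsto (fun n : ℕ => (n * h n ^ k) / (β n ^ 2 * Real.log n)) atTop atTop) :
    ∃ (T : ℕ → Finset (E d)) (c q : ℕ) (δ : ℕ → ℝ), (∀ᶠ n in atTop, ↑(T n) ⊆ M₀) ∧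
      (∀ᶠ n in atTop, (T n).card ≤ c * n ^ q) ∧
      (∀ᶠ n in atTop, ∀ x ∈ M₀, ∃ y ∈ T n, ‖x - y‖ ≤ δ n) ∧
      Tendsto (fun n => δ n * β n / h n ^ (k + 1)) atTop (𝓝 0) := by
  rcases Nat.eq_zero_or_pos k with hk | hk
  · refine ⟨fun _ => (hfin hk).toFinset, (hfin hk).toFinset.card, 0, 0, ?_, ?_, ?_, ?_⟩
    · exact Eventually.of_forall fun n => by simp
    · exact Eventually.of_forall fun n => by simp
    · exact Eventually.of_forall fun n x hx => ⟨x, by simpa using hx, by simp⟩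
    · simp
  -- the rate forces `1 / h n ≤ n` and `β n ≤ n`, so a mesh of `n⁻⁴` suffices
  · obtain ⟨c, hc⟩ := exists_finset_net hM₀
    choose! T hT1 hT2 hT3 using hc
    refine ⟨fun n => T (n ^ 4), c ^ d, 4 * d, fun n => 1 / (n : ℝ) ^ 4, ?_, ?_, ?_, ?_⟩
    · filter_upwards [eventually_gt_atTop 0] with n hn using hT1 _ (by positivity)
    · filter_upwards [eventually_gt_atTop 0] with n hn
      refine (hT2 _ (by positivity)).trans_eq ?_
      rw [mul_pow, ← pow_mul]
    · filter_upwards [eventually_gt_atTop 0] with n hn x hx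
      obtain ⟨y, hy, hxy⟩ := hT3 (n ^ 4) (by positivity) x hx
      exact ⟨y, hy, hxy.trans_eq (by push_cast; rfl)⟩
    · have hlog : ∀ᶠ n : ℕ in atTop, 1 ≤ Real.log n :=
        (Real.tendsto_log_atTop.comp tendsto_natCast_atTop_atTop).eventually_ge_atTop 1
      refine squeeze_zero' ?_ ?_ tendsto_one_div_atTop_nhds_zero_nat
      · filter_upwards [hβ.eventually_ge_atTop 1] with n hn
        have := h_pos n
        positivity
      · filter_upwards [hβ.eventually_ge_atTop 1, hlog, h_zero.eventually_le_const one_pos,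
          hrate.eventually_ge_atTop 1, eventually_gt_atTop 0] with n hβn hln hh1 hr hn
        have hh := h_pos n
        have hn' : (0 : ℝ) < n := by exact_mod_cast hn
        rw [le_div_iff₀ (by positivity), one_mul] at hr
        have hb2 : β n ≤ β n ^ 2 * Real.log n := by nlinarith
        have hhk : h n ^ k ≤ h n := pow_le_of_le_one hh.le hh1 hk.ne'
        have hk1 : h n ^ k ≤ 1 := pow_le_one₀ hh.le hh1
        have hβle : β n ≤ n := by nlinarith
        have h1 : 1 ≤ n * h n ^ k := by linarith
        have h2 : 1 ≤ n * h n := by nlinarith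
        have h3 : 1 ≤ (n : ℝ) ^ 2 * h n ^ (k + 1) := by
          calc (1 : ℝ) ≤ (n * h n ^ k) * (n * h n) := by nlinarith
            _ = _ := by ring
        rw [div_le_div_iff₀ (by positivity) hn', one_mul, div_mul_eq_mul_div, div_mul_eq_mul_div,
          one_mul, div_le_iff₀ (by positivity)]
        calc β n * n ≤ n * n * 1 := by rw [mul_one]; gcongr
          _ ≤ n * n * (n ^ 2 * h n ^ (k + 1)) := by gcongr
          _ = _ := by ring

/-- Almost surely, the fluctuation of the kernel sums is negligible, uniformly. -/
theorem ae_eventually_abs_sum_sub_le {d k : ℕ} {Ω : Type*} [MeasurableSpace Ω] {P : Measure Ω}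
    [IsProbabilityMeasure P] {X : ℕ → Ω → E d} (hX : ∀ i, Measurable (X i))
    (hindep : iIndepFun X P) (hid : ∀ i, P.map (X i) = P.map (X 0))
    {M₀ : Set (E d)} (hM₀ : Bornology.IsBounded M₀)
    (hfin : k = 0 → M₀.Finite) {h β : ℕ → ℝ} (h_pos : ∀ n, 0 < h n)
    (h_zero : Tendsto h atTop (𝓝 0)) (hβ : Tendsto β atTop atTop)
    (hrate : Tendsto (fun n : ℕ => (n * h n ^ k) / (β n ^ 2 * Real.log n)) atTop atTop)
    {B : ℝ} (hB : 1 ≤ B) (hmean : ∀ᶠ n in atTop, ∀ x ∈ M₀,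
      ∫ ω, Real.exp (-(‖x - X 0 ω‖ ^ 2 / h n ^ 2)) ∂P ≤ B * h n ^ k) {ε : ℝ} (hε : 0 < ε)
    (hε1 : ε ≤ 1) :
    ∀ᵐ ω ∂P, ∀ᶠ n in atTop, ∀ x ∈ M₀,
      |∑ i ∈ Finset.range n, Real.exp (-(‖x - X i ω‖ ^ 2 / h n ^ 2)) -
        n * ∫ ω, Real.exp (-(‖x - X 0 ω‖ ^ 2 / h n ^ 2)) ∂P| ≤ ε * (n * h n ^ k / β n) := by
  obtain ⟨T, c, q, δ, hT, hcard, hnet, hδ⟩ := exists_nets hM₀ hfin h_pos h_zero hβ hrate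
  set m : ℕ → E d → ℝ := fun n x => ∫ ω, Real.exp (-(‖x - X 0 ω‖ ^ 2 / h n ^ 2)) ∂P with hm
  set S : ℕ → E d → Ω → ℝ := fun n x ω =>
    ∑ i ∈ Finset.range n, Real.exp (-(‖x - X i ω‖ ^ 2 / h n ^ 2)) - n * m n x with hS
  have hGc : ∀ n (x : E d), Continuous fun y : E d => Real.exp (-(‖x - y‖ ^ 2 / h n ^ 2)) :=
    fun n x => by fun_prop
  have hG0 : ∀ n (x y : E d), 0 ≤ Real.exp (-(‖x - y‖ ^ 2 / h n ^ 2)) := fun n x y => by positivity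
  have hG1 : ∀ n (x y : E d), Real.exp (-(‖x - y‖ ^ 2 / h n ^ 2)) ≤ 1 := fun n x y =>
    Real.exp_le_one_iff.2 (by simp only [Left.neg_nonpos_iff]; positivity)
  have hGm : ∀ n (x : E d) i, ∫ ω, Real.exp (-(‖x - X i ω‖ ^ 2 / h n ^ 2)) ∂P = m n x :=
    fun n x i => by
      rw [hm, ← integral_map (φ := X i) (hX i).aemeasurable (hGc n x).aestronglyMeasurable, hid i,
        integral_map (hX 0).aemeasurable (hGc n x).aestronglyMeasurable]
  -- by the union bound over the net, these events have summable probabilities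
  let bad : ℕ → Set Ω := fun n => {ω | ∃ y ∈ T n, ε / 2 * (n * h n ^ k / β n) ≤ |S n y ω|}
  have hbad : ∀ᶠ n in atTop, P.real (bad n) ≤ 2 * c * (1 / (n : ℝ) ^ 2) := by
    filter_upwards [hT, hcard, hmean, hβ.eventually_ge_atTop 1, eventually_gt_atTop 1,
      hrate.eventually_ge_atTop (16 * B * (q + 2) / ε ^ 2)] with n hTn hcn hmn hβn hn hrn
    have hh := h_pos n
    have hn' : (1 : ℝ) < n := by exact_mod_cast hn
    have hlog : 0 < Real.log n := Real.log_pos hn'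
    have hpt : ∀ y ∈ T n, P.real {ω | ε / 2 * (n * h n ^ k / β n) ≤ |S n y ω|} ≤
        2 * (1 / (n : ℝ) ^ (q + 2)) := fun y hy => by
      -- this parameter of the exponential moment minimises the exponent
      have ht1 : ε / (4 * B * β n) ≤ 1 := by
        rw [div_le_one (by positivity)]
        nlinarith
      refine (measureReal_abs_sum_sub_ge_le hX hindep (hGc n y).measurable (hG0 n y) (hG1 n y)
        (hGm n y) (hmn y (hTn hy)) (t := ε / (4 * B * β n)) (by positivity) ht1 _ n).trans ?_
      have hexp : -(ε / (4 * B * β n)) * (ε / 2 * (n * h n ^ k / β n)) +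
          n * ((ε / (4 * B * β n)) ^ 2 * (B * h n ^ k)) =
          -(ε ^ 2 / (16 * B) * (n * h n ^ k / β n ^ 2)) := by
        field_simp
        ring
      have hle : (q + 2) * Real.log n ≤ ε ^ 2 / (16 * B) * (n * h n ^ k / β n ^ 2) := by
        rw [div_le_div_iff₀ (by positivity) (by positivity)] at hrn
        rw [div_mul_div_comm, le_div_iff₀ (by positivity)]
        nlinarith
      have hpow : 1 / (n : ℝ) ^ (q + 2) = Real.exp (-((q + 2) * Real.log n)) := by
        rw [Real.exp_neg, one_div, mul_comm, Real.exp_mul, Real.exp_log (by positivity)]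
        norm_cast
      rw [hexp, hpow]
      gcongr
    have hsub : bad n ⊆ ⋃ y ∈ T n, {ω | ε / 2 * (n * h n ^ k / β n) ≤ |S n y ω|} := by
      rintro ω ⟨y, hy, hω⟩
      exact mem_iUnion₂.2 ⟨y, hy, hω⟩
    calc P.real (bad n) ≤ _ := measureReal_mono hsub (measure_ne_top _ _)
      _ ≤ ∑ y ∈ T n, P.real {ω | ε / 2 * (n * h n ^ k / β n) ≤ |S n y ω|} :=
          measureReal_biUnion_finset_le _ _
      _ ≤ (T n).card • (2 * (1 / (n : ℝ) ^ (q + 2))) := Finset.sum_le_card_nsmul _ _ _ hpt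
      _ ≤ (c * n ^ q : ℕ) • (2 * (1 / (n : ℝ) ^ (q + 2))) := by gcongr
      _ = _ := by
          rw [nsmul_eq_mul]
          push_cast
          rw [pow_add]
          field_simp
  have hsum : ∑' n, P (bad n) ≠ ∞ := by
    have h1 : Summable fun n => P.real (bad n) :=
      Summable.of_norm_bounded_eventually_nat
        (((Real.summable_one_div_nat_pow (p := 2)).2 one_lt_two).mul_left (2 * c : ℝ))
        (hbad.mono fun n hn => by rwa [Real.norm_of_nonneg measureReal_nonneg])
    have h2 := h1.tsum_ofReal_ne_top
    simpa using h2
  filter_upwards [ae_eventually_notMem hsum] with ω hω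
  filter_upwards [hω, hnet, hβ.eventually_ge_atTop 1,
    hδ.eventually_le_const (show (0 : ℝ) < ε / 4 by positivity)] with n hn hnetn hβn hδn x hx
  -- pass from `x` to a nearby point of the net
  obtain ⟨y, hy, hxy⟩ := hnetn x hx
  have hh := h_pos n
  have h1 : |S n y ω| < ε / 2 * (n * h n ^ k / β n) := by
    by_contra hlt
    exact hn ⟨y, hy, not_lt.1 hlt⟩
  have hGxy : ∀ z : E d, |Real.exp (-(‖x - z‖ ^ 2 / h n ^ 2)) -
      Real.exp (-(‖y - z‖ ^ 2 / h n ^ 2))| ≤ δ n / h n := fun z =>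
    (abs_gauss_sub_le hh x y z).trans (by gcongr)
  have hGi : ∀ z : E d, Integrable (fun ω => Real.exp (-(‖z - X 0 ω‖ ^ 2 / h n ^ 2))) P := fun z =>
    Integrable.of_bound ((hGc n z).measurable.comp (hX 0)).aestronglyMeasurable 1
      (ae_of_all _ fun ω => by rw [Real.norm_of_nonneg (hG0 n z _)]; exact hG1 n z _)
  have hmxy : |m n x - m n y| ≤ δ n / h n := by
    rw [hm, ← integral_sub (hGi x) (hGi y)]
    refine abs_integral_le_integral_abs.trans ?_
    refine (integral_mono ((hGi x).sub (hGi y)).abs (integrable_const (δ n / h n))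
      fun ω => hGxy _).trans_eq ?_
    simp
  have hSxy : |S n x ω - S n y ω| ≤ 2 * (n * (δ n / h n)) := by
    have h2 : S n x ω - S n y ω = ∑ i ∈ Finset.range n, (Real.exp (-(‖x - X i ω‖ ^ 2 / h n ^ 2)) -
        Real.exp (-(‖y - X i ω‖ ^ 2 / h n ^ 2))) - n * (m n x - m n y) := by
      rw [hS, Finset.sum_sub_distrib]; ring
    rw [h2]
    refine (abs_sub _ _).trans ?_
    rw [abs_mul, Nat.abs_cast, two_mul]
    refine add_le_add ?_ (by gcongr)
    refine (Finset.abs_sum_le_sum_abs _ _).trans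
      ((Finset.sum_le_sum fun i _ => hGxy (X i ω)).trans_eq ?_)
    simp
  have hδ' : 2 * (n * (δ n / h n)) ≤ ε / 2 * (n * h n ^ k / β n) := by
    rw [div_le_iff₀ (by positivity)] at hδn
    calc 2 * (n * (δ n / h n)) = 2 * n / (h n * β n) * (δ n * β n) := by field_simp
      _ ≤ 2 * n / (h n * β n) * (ε / 4 * h n ^ (k + 1)) := by gcongr
      _ = _ := by field_simp; ring
  calc |S n x ω| = |S n y ω + (S n x ω - S n y ω)| := by congr 1; ring
    _ ≤ |S n y ω| + |S n x ω - S n y ω| := abs_add_le _ _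
    _ ≤ _ := by linarith

/-! ### Uniform consistency of the estimator -/

theorem geodesicDist_self {d : ℕ} {M : Set (E d)} {x : E d} (hx : x ∈ M) :
    geodesicDist M x x = 0 := by
  refine le_antisymm ?_ zero_le
  refine iInf_le_of_le (fun _ : ℝ => x) (iInf_le_of_le contDiffOn_const
    (iInf_le_of_le (fun _ _ => hx) (iInf_le_of_le rfl (iInf_le_of_le rfl ?_))))
  simp

/-- Constant paths have length zero, so a set at positive geodesic distance from the boundary is
disjoint from it; by compactness this is all that is needed. -/
theorem disjoint_bdry_of_pos {d k : ℕ} {M M₀ : Set (E d)} (hM₀M : M₀ ⊆ M)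
    (hpos : 0 < ⨅ x ∈ M₀, geodesicDistSet M x (bdry k M)) : Disjoint M₀ (bdry k M) := by
  refine Set.disjoint_left.2 fun x hx hxb => hpos.not_ge ?_
  exact (iInf₂_le x hx).trans ((iInf₂_le x hxb).trans (geodesicDist_self (hM₀M hx)).le)

theorem kernelEstimator_eq {d : ℕ} (k : ℕ) (h : ℝ) (n : ℕ) (X : ℕ → E d) (x : E d) :
    kernelEstimator k h n X x = 1 / (n * h ^ k) * (Real.pi ^ (-(k : ℝ) / 2) *
      ∑ i ∈ Finset.range n, Real.exp (-(‖x - X i‖ ^ 2 / h ^ 2))) := by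
  simp only [kernelEstimator, gaussKernel, div_pow, Finset.mul_sum]

theorem abs_kernelEstimator_le {d : ℕ} (k : ℕ) {h : ℝ} (hh : 0 < h) (n : ℕ) (X : ℕ → E d)
    (x : E d) : |kernelEstimator k h n X x| ≤ 1 / (n * h ^ k) * (Real.pi ^ (-(k : ℝ) / 2) * n) := by
  rw [kernelEstimator_eq, abs_of_nonneg (by positivity)]
  gcongr
  calc _ ≤ ∑ i ∈ Finset.range n, (1 : ℝ) := Finset.sum_le_sum fun i _ =>
        Real.exp_le_one_iff.2 (by simp only [Left.neg_nonpos_iff]; positivity)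
    _ = n := by simp

/-- The error of the estimator splits into the fluctuation of the kernel sum and its bias. -/
theorem abs_kernelEstimator_sub_le {d k n : ℕ} {h : ℝ} (hh : 0 < h) (hn : 0 < n) {X : ℕ → E d}
    {x : E d} {m y a b : ℝ}
    (hfluct : |∑ i ∈ Finset.range n, Real.exp (-(‖x - X i‖ ^ 2 / h ^ 2)) - n * m| ≤
      a * (n * h ^ k))
    (hbias : |m - y * (Real.pi ^ ((k : ℝ) / 2) * h ^ k)| ≤ b * h ^ k) :
    |kernelEstimator k h n X x - y| ≤ a + b := by
  have hn' : (0 : ℝ) < n := by exact_mod_cast hn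
  have hπ1 : Real.pi ^ (-(k : ℝ) / 2) ≤ 1 :=
    Real.rpow_le_one_of_one_le_of_nonpos (by linarith [Real.pi_gt_three])
      (by have : (0 : ℝ) ≤ k := k.cast_nonneg
          linarith)
  have hππ : Real.pi ^ (-(k : ℝ) / 2) * Real.pi ^ ((k : ℝ) / 2) = 1 := by
    rw [← Real.rpow_add Real.pi_pos, neg_div, neg_add_cancel, Real.rpow_zero]
  have h1 : kernelEstimator k h n X x - y = Real.pi ^ (-(k : ℝ) / 2) *
      ((∑ i ∈ Finset.range n, Real.exp (-(‖x - X i‖ ^ 2 / h ^ 2)) - n * m) / (n * h ^ k) +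
        (m - y * (Real.pi ^ ((k : ℝ) / 2) * h ^ k)) / h ^ k) := by
    have h2 : y = Real.pi ^ (-(k : ℝ) / 2) * Real.pi ^ ((k : ℝ) / 2) * y := by rw [hππ, one_mul]
    rw [kernelEstimator_eq]
    nth_rewrite 1 [h2]
    field_simp
    ring
  rw [h1, abs_mul, abs_of_pos (by positivity)]
  calc _ ≤ 1 * (a + b) := by
        refine mul_le_mul hπ1 ((abs_add_le _ _).trans (add_le_add ?_ ?_)) (abs_nonneg _) zero_le_one
        · rw [abs_div, abs_of_pos (show (0 : ℝ) < n * h ^ k by positivity),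
            div_le_iff₀ (by positivity)]
          exact hfluct
        · rw [abs_div, abs_of_pos (show (0 : ℝ) < h ^ k by positivity), div_le_iff₀ (by positivity)]
          exact hbias
    _ = _ := one_mul _

end ManifoldKDE

open ManifoldKDE in
theorem theorem1 {d d' : ℕ} {M : Set (ManifoldKDE.E d)}
    (hMcompact : IsCompact M) (hM : ManifoldKDE.IsC2Submanifold d' M)
    {f : ManifoldKDE.E d → ℝ} (hf_nonneg : ∀ x ∈ M, 0 ≤ f x)
    (hf : ManifoldKDE.IsC2FunctionOn f M)
    {Ω : Type*} [MeasurableSpace Ω] {P : Measure Ω} [IsProbabilityMeasure P]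
    {X : ℕ → Ω → ManifoldKDE.E d} (hX : ∀ i, Measurable (X i)) (hindep : iIndepFun X P)
    (hlaw : ∀ i, P.map (X i) =
      (ManifoldKDE.volumeMeasure d' M).withDensity (fun x => ENNReal.ofReal (f x)))
    {h β : ℕ → ℝ} (h_pos : ∀ n, 0 < h n) (h_zero : Tendsto h atTop (𝓝 0))
    (hβ : Tendsto β atTop atTop)
    (hβh : Tendsto (fun n => β n * h n ^ 2) atTop (𝓝 0))
    (hrate : Tendsto (fun n : ℕ => (n * h n ^ d') / (β n ^ 2 * Real.log n)) atTop atTop)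
    {M₀ : Set (ManifoldKDE.E d)} (hM₀closed : IsClosed M₀) (hM₀M : M₀ ⊆ M)
    (hM₀bdry : 0 < ⨅ x ∈ M₀, ManifoldKDE.geodesicDistSet M x (ManifoldKDE.bdry d' M)) :
    ∀ᵐ ω ∂P,
      (∀ n, BddAbove (range fun x : M₀ =>
        |ManifoldKDE.kernelEstimator d' (h n) n (fun i => X i ω) x - f x|)) ∧
      Tendsto (fun n => β n *
        ⨆ x : M₀, |ManifoldKDE.kernelEstimator d' (h n) n (fun i => X i ω) x - f x|)
        atTop (𝓝 0) := by
  have hM₀ : IsCompact M₀ := hMcompact.of_isClosed_subset hM₀closed hM₀M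
  have hMm : MeasurableSet M := hMcompact.measurableSet
  have hint : ∀ p ∈ M₀, IsInteriorPt d' M p := fun p hp =>
    (hM.2 p (hM₀M hp)).resolve_right (Set.disjoint_left.1 (disjoint_bdry_of_pos hM₀M hM₀bdry) hp)
  have hfc : ContinuousOn f M := hf.continuousOn
  have hfm : AEMeasurable (fun x => ENNReal.ofReal (f x)) (volumeMeasure d' M) :=
    (hfc.aemeasurable hMm).ennreal_ofReal
  -- the density has total mass one
  have hmass : ∫⁻ y in M, ENNReal.ofReal (f y) ∂(Measure.euclideanHausdorffMeasure d') = 1 := by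
    have h1 : (P.map (X 0)) univ = 1 := by
      rw [Measure.map_apply (hX 0) MeasurableSet.univ, preimage_univ, measure_univ]
    rw [hlaw 0, withDensity_apply _ MeasurableSet.univ, Measure.restrict_univ] at h1
    exact h1
  have hfnn : 0 ≤ᵐ[(Measure.euclideanHausdorffMeasure d').restrict M] f := by
    filter_upwards [ae_restrict_mem hMm] with y hy using hf_nonneg y hy
  have hfi : IntegrableOn f M (Measure.euclideanHausdorffMeasure d') := by
    refine ⟨(hfc.aemeasurable hMm).aestronglyMeasurable, ?_⟩
    rw [hasFiniteIntegral_iff_ofReal hfnn, hmass]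
    exact ENNReal.one_lt_top
  have hf1 : ∫ y in M, f y ∂(Measure.euclideanHausdorffMeasure d') ≤ 1 := by
    rw [integral_eq_lintegral_of_nonneg_ae hfnn hfi.1, hmass, ENNReal.toReal_one]
  obtain ⟨A, hA⟩ := exists_bias_le_of_isCompact hM.1 hMm hf_nonneg hf hfi hf1 hM₀ hM₀M hint
  obtain ⟨F, hF⟩ := hM₀.exists_bound_of_continuousOn (hfc.mono hM₀M)
  -- the mean of the kernel, as an integral over the manifold
  have hmean : ∀ n (x : E d), ∫ ω, Real.exp (-(‖x - X 0 ω‖ ^ 2 / h n ^ 2)) ∂P =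
      ∫ y in M, Real.exp (-(‖x - y‖ ^ 2 / h n ^ 2)) * f y
        ∂(Measure.euclideanHausdorffMeasure d') := fun n x => by
    have hc : Continuous fun y : E d => Real.exp (-(‖x - y‖ ^ 2 / h n ^ 2)) := by fun_prop
    rw [← integral_map (φ := X 0) (hX 0).aemeasurable hc.aestronglyMeasurable, hlaw 0,
      integral_withDensity_eq_integral_toReal_smul₀ hfm
        (ae_of_all _ fun y => ENNReal.ofReal_lt_top)]
    refine setIntegral_congr_fun hMm fun y hy => ?_
    simp only [ENNReal.toReal_ofReal (hf_nonneg y hy), smul_eq_mul, mul_comm]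
  have hh1 : ∀ᶠ n in atTop, h n ≤ 1 := h_zero.eventually_le_const one_pos
  have hbound : ∀ᶠ n in atTop, ∀ x ∈ M₀, ∫ ω, Real.exp (-(‖x - X 0 ω‖ ^ 2 / h n ^ 2)) ∂P ≤
      (1 + |F| * Real.pi ^ ((d' : ℝ) / 2) + |A|) * h n ^ d' := by
    filter_upwards [hh1] with n hn x hx
    have hh := h_pos n
    have h1 := (abs_le.1 (hA x hx (h n) hh hn)).2
    have h2 : f x ≤ |F| := (le_abs_self _).trans ((hF x hx).trans (le_abs_self F))
    have h3 : A * h n ^ (d' + 2) ≤ |A| * h n ^ d' :=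
      mul_le_mul (le_abs_self A) (pow_le_pow_of_le_one hh.le hn (by lia)) (by positivity)
        (abs_nonneg A)
    have h4 : f x * (Real.pi ^ ((d' : ℝ) / 2) * h n ^ d') ≤
        |F| * (Real.pi ^ ((d' : ℝ) / 2) * h n ^ d') := by gcongr
    have h5 : 0 < h n ^ d' := by positivity
    rw [hmean]
    linarith
  have hconc := fun j : ℕ => ae_eventually_abs_sum_sub_le (P := P) hX hindep
    (fun i => (hlaw i).trans (hlaw 0).symm) hM₀.isBounded
    (fun hk => by subst hk; exact finite_of_isInteriorPt_zero hM₀ hM₀M hint) h_pos h_zero hβ hrate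
    (by have : 0 ≤ |F| * Real.pi ^ ((d' : ℝ) / 2) + |A| := by positivity
        linarith) hbound
    (ε := 1 / ((j : ℝ) + 1)) (by positivity)
    (by rw [div_le_one (by positivity)]; linarith [(Nat.cast_nonneg j : (0 : ℝ) ≤ j)])
  filter_upwards [ae_all_iff.2 hconc] with ω hω
  refine ⟨fun n => ?_, ?_⟩
  · refine ⟨1 / (n * h n ^ d') * (Real.pi ^ (-(d' : ℝ) / 2) * n) + F, ?_⟩
    rintro _ ⟨x, rfl⟩
    exact (abs_sub _ _).trans (add_le_add (abs_kernelEstimator_le d' (h_pos n) n _ _) (hF x x.2))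
  · rw [Metric.tendsto_nhds]
    intro η hη
    obtain ⟨j, hj⟩ := exists_nat_one_div_lt (show 0 < η / 2 by positivity)
    have hAh : Tendsto (fun n => |A| * (β n * h n ^ 2)) atTop (𝓝 0) := by
      simpa using hβh.const_mul |A|
    filter_upwards [hω j, hh1, hβ.eventually_ge_atTop 1, eventually_gt_atTop 0,
      hAh.eventually_lt_const (show 0 < η / 2 by positivity)] with n hn hhn hβn hn0 hAn
    have hh := h_pos n
    have hsup : ⨆ x : M₀, |kernelEstimator d' (h n) n (fun i => X i ω) x - f x| ≤
        1 / ((j : ℝ) + 1) / β n + |A| * h n ^ 2 := by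
      refine Real.iSup_le (fun x => ?_) (by positivity)
      refine abs_kernelEstimator_sub_le hh hn0 ((hn x x.2).trans_eq (by ring)) ?_
      rw [hmean]
      refine (hA x x.2 (h n) hh hhn).trans ?_
      rw [pow_add, mul_assoc, mul_comm (h n ^ 2)]
      gcongr
      exact le_abs_self A
    rw [Real.dist_eq, sub_zero, abs_of_nonneg
      (mul_nonneg (by linarith) (Real.iSup_nonneg fun x => abs_nonneg _))]
    calc _ ≤ β n * (1 / ((j : ℝ) + 1) / β n + |A| * h n ^ 2) := by gcongr
      _ = 1 / ((j : ℝ) + 1) + |A| * (β n * h n ^ 2) := by field_simp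
      _ < η := by linarith
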